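/- Let $\mathcal C$ be a small category with finite products, and let $sPre(\mathcal C)$ be the category of functors $\mathcal C^{op}\to s\mathbf{Set}$; identify $X\in\mathcal C$ with the presheaf it represents, and presheaves of sets with simplicial presheaves of dimension zero. For $F\in sPre(\mathcal C)$ and a simplicial set $K$ let $F\otimes K$ be the objectwise product; let $\mathrm{Map}(F,G)$ be the simplicial set with $n$-simplices the maps $F\otimes\Delta^n\to G$, and let $\mathrm{HOM}(F,G)$ be the internal function object, so that maps $A\to\mathrm{HOM}(F,G)$ correspond to maps $A\times F\to G$. For maps $f\colon F\to G$ and $g\colon A\to B$ in $sPre(\mathcal C)$ the pushout product $f\,\Box\, g$ is the map $G\times A\coprod_{F\times A}F\times B\to G\times B$; the same formula, with $\otimes$ for $\times$, is used when $g$ is a map of simplicial sets. A map $f$ in $sPre(\mathcal C)$ is an objectwise weak equivalence if $f(X)$ is a weak equivalence of simplicial sets for every $X\in\mathcal C$. For a (possibly empty) finite collection $\mathcal U$ of monomorphisms $U_i\to X$ in $\mathcal C$, let $\cup\mathcal U$ be the coequalizer, in presheaves, of the two projections $\coprod_{i,j}U_i\times_X U_j\rightrightarrows\coprod_i U_i$.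 Let $J$ be the set of all maps $(\cup\mathcal U\to X)\,\Box\,(\Lambda^{n,k}\to\Delta^n)$ with $X\in\mathcal C$, $\mathcal U$ as above, $n\ge 1$ and $0\le k\le n$. A flasque fibration is a map in $sPre(\mathcal C)$ with the right lifting property with respect to $J$; a flasque cofibration is a map with the left lifting property with respect to all flasque fibrations that are objectwise weak equivalences. 1. If $f\colon F\to G$ and $g\colon A\to B$ are flasque cofibrations, then $f\,\Box\, g$ is a flasque cofibration, and it is an objectwise weak equivalence if $f$ or $g$ is. 2. If $i\colon A\to B$ is a flasque cofibration and $f\colon F\to G$ is a flasque fibration, then the induced map $$\mathrm{HOM}(B,F)\to\mathrm{HOM}(A,F)\times_{\mathrm{HOM}(A,G)}\mathrm{HOM}(B,G)$$ is a flasque fibration, and it is an objectwise weak equivalence if $i$ or $f$ is. 3. If $i\colon A\to B$ is a flasque cofibration and $f\colon F\to G$ is a flasque fibration, then the induced map $$\mathrm{Map}(B,F)\to\mathrm{Map}(A,F)\times_{\mathrm{Map}(A,G)}\mathrm{Map}(B,G)$$ is a Kan fibration of simplicial sets, and it is a weak equivalence if $i$ or $f$ is an objectwise weak equivalence. -/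

import Mathlib

open CategoryTheory Limits MonoidalCategory Opposite

universe u

noncomputable section

namespace Flasque

/-! ### Weak equivalences of simplicial sets -/

/-- Homotopy classes of maps `K ⟶ Z`: the quotient of the set of maps by the equivalence relation
generated by simplicial homotopy `K ⊗ Δ[1] ⟶ Z` (for a Kan complex `Z` the homotopy relation is
already an equivalence relation). -/
def HomotopyClasses (K Z : SSet.{u}) : Type u :=
  Quot (fun a b : K ⟶ Z => Nonempty (SSet.Homotopy a b))

/-- Precomposition with `f : K ⟶ L` sends homotopies to homotopies. -/
theorem homotopy_precomp {K L Z : SSet.{u}} (f : K ⟶ L) (a b : L ⟶ Z)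
    (h : Nonempty (SSet.Homotopy a b)) : Nonempty (SSet.Homotopy (f ≫ a) (f ≫ b)) := by
  obtain ⟨H⟩ := h
  exact ⟨{ h := f ▷ _ ≫ H.h
           h₀ := by
             rw [SSet.ι₀_comp_assoc, SSet.Homotopy.h₀]; rfl
           h₁ := by
             rw [SSet.ι₁_comp_assoc, SSet.Homotopy.h₁]; rfl
           rel := by
             ext n x
             exact (x.1.2 : False).elim }⟩

/-- Precomposition with `f : K ⟶ L` on homotopy classes of maps into `Z`. -/
def HomotopyClasses.precomp {K L : SSet.{u}} (f : K ⟶ L) (Z : SSet.{u}) :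
    HomotopyClasses L Z → HomotopyClasses K Z :=
  Quot.map (fun a => f ≫ a) (homotopy_precomp f)

/-- Weak (homotopy) equivalences of simplicial sets: the maps which induce, for every Kan
complex `Z`, a bijection on homotopy classes of maps into `Z`. -/
def weakEquivalences : MorphismProperty SSet.{u} := fun _ _ f =>
  ∀ Z : SSet.{u}, SSet.KanComplex Z → Function.Bijective (HomotopyClasses.precomp f Z)

/-- Kan fibrations of simplicial sets. -/
def kanFibrations : MorphismProperty SSet.{u} := SSet.modelCategoryQuillen.J.rlp

/-! ### Simplicial presheaves -/

/-- Simplicial presheaves on a small category `C`. -/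
abbrev SPre (C : Type u) [SmallCategory C] : Type (u + 1) := Cᵒᵖ ⥤ SSet.{u}

section

variable {C : Type u} [SmallCategory C]

/-- The category of simplicial presheaves is cartesian closed; the internal function object
`HOM(F, G)` is `(ihom F).obj G`, so that maps `A ⟶ HOM(F, G)` are the maps `F ⊗ A ⟶ G`, where
`⊗` is the cartesian product. -/
instance : MonoidalClosed (SPre C) := MonoidalClosed.FunctorCategory.monoidalClosed

/-- Objectwise weak equivalences. -/
def objectwiseWeq : MorphismProperty (SPre C) := fun _ _ f =>
  ∀ X : C, weakEquivalences (f.app (op X))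

variable (C) in
/-- The functor sending a presheaf of sets to the simplicial presheaf of dimension zero it
defines. -/
def discrete : (Cᵒᵖ ⥤ Type u) ⥤ SPre C :=
  (Functor.whiskeringRight Cᵒᵖ (Type u) SSet.{u}).obj (Functor.const SimplexCategoryᵒᵖ)

variable (C) in
/-- The functor sending a simplicial set to the constant simplicial presheaf, so that the tensor
of a simplicial presheaf `F` with a simplicial set `K`, i.e. the objectwise product of `F`
with `K`, is `F ⊗ (constant C).obj K`. -/
abbrev constant : SSet.{u} ⥤ SPre C := Functor.const Cᵒᵖ

/-- The pushout product `G ⊗ A ⨿_{F ⊗ A} F ⊗ B ⟶ G ⊗ B` of two maps `f : F ⟶ G` and `g : A ⟶ B`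
of simplicial presheaves, where `⊗` is the cartesian product. -/
abbrev pushoutProduct {F G A B : SPre C} (f : F ⟶ G) (g : A ⟶ B) :
    pushout (f ▷ A) (F ◁ g) ⟶ G ⊗ B :=
  pushout.desc (G ◁ g) (f ▷ B) (whisker_exchange f g).symm

/-- The map `HOM(B, F) ⟶ HOM(A, F) ×_{HOM(A, G)} HOM(B, G)` induced by `i : A ⟶ B` and
`f : F ⟶ G`. -/
abbrev homPullback {A B F G : SPre C} (i : A ⟶ B) (f : F ⟶ G) :
    (ihom B).obj F ⟶ pullback ((ihom A).map f) ((MonoidalClosed.pre i).app G) :=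
  pullback.lift ((MonoidalClosed.pre i).app F) ((ihom B).map f)
    ((MonoidalClosed.pre i).naturality f).symm

variable (C) in
/-- The simplicial mapping space `Map(F, G)`, as a bifunctor: an `n`-simplex of `Map(F, G)` is a
map `F ⊗ Δ[n] ⟶ G` of simplicial presheaves. -/
def mapFunctor : (SPre C)ᵒᵖ ⥤ SPre C ⥤ SSet.{u} where
  obj F :=
    { obj G := (SSet.stdSimplex ⋙ constant C ⋙ tensorLeft F.unop).op ⋙ yoneda.obj G
      map g := Functor.whiskerLeft _ (yoneda.map g) }
  map i :=
    { app G := Functor.whiskerRight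
        (NatTrans.op (Functor.whiskerLeft (SSet.stdSimplex ⋙ constant C)
          ((curriedTensor (SPre C)).map i.unop))) (yoneda.obj G) }

/-- The simplicial mapping space `Map(F, G)`. -/
abbrev Map (F G : SPre C) : SSet.{u} := ((mapFunctor C).obj (op F)).obj G

/-- The map `Map(B, F) ⟶ Map(A, F) ×_{Map(A, G)} Map(B, G)` induced by `i : A ⟶ B` and
`f : F ⟶ G`. -/
abbrev mapPullback {A B F G : SPre C} (i : A ⟶ B) (f : F ⟶ G) :
    Map B F ⟶ pullback (((mapFunctor C).obj (op A)).map f) (((mapFunctor C).map i.op).app G) :=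
  pullback.lift (((mapFunctor C).map i.op).app F) (((mapFunctor C).obj (op B)).map f) (by simp)

/-! ### Unions of finite collections of monomorphisms -/

section Union

variable {X : C} {n : ℕ} {U : Fin n → C} (i : ∀ a, U a ⟶ X)

/-- The first map `∐_{a, b} U a ×_X U b ⟶ ∐_a U a`, given by the first projections. Objects of `C`
are identified with the presheaves they represent. -/
def unionFst :
    (∐ fun p : Fin n × Fin n => pullback (yoneda.map (i p.1)) (yoneda.map (i p.2))) ⟶
      ∐ fun a => yoneda.obj (U a) :=
  Sigma.desc fun p => pullback.fst _ _ ≫ Sigma.ι (fun a => yoneda.obj (U a)) p.1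

/-- The second map `∐_{a, b} U a ×_X U b ⟶ ∐_a U a`, given by the second projections. -/
def unionSnd :
    (∐ fun p : Fin n × Fin n => pullback (yoneda.map (i p.1)) (yoneda.map (i p.2))) ⟶
      ∐ fun a => yoneda.obj (U a) :=
  Sigma.desc fun p => pullback.snd _ _ ≫ Sigma.ι (fun a => yoneda.obj (U a)) p.2

/-- The presheaf `∪ U`: the coequalizer of `∐_{a, b} U a ×_X U b ⇉ ∐_a U a`. -/
def union : Cᵒᵖ ⥤ Type u := coequalizer (unionFst i) (unionSnd i)

/-- The canonical map `∪ U ⟶ X`. -/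
def unionMap : union i ⟶ yoneda.obj X :=
  coequalizer.desc (Sigma.desc fun a => yoneda.map (i a)) (by
    apply Sigma.hom_ext
    rintro ⟨a, b⟩
    simp [unionFst, unionSnd, pullback.condition])

end Union

/-! ### Flasque fibrations and cofibrations -/

variable (C) in
/-- The set `J` of maps `f □ g`, where `f : ∪ U ⟶ X` is induced by a (possibly empty) finite
collection of monomorphisms into an object `X` of `C`, and `g` is a horn inclusion. -/
inductive generatingAcyclicCofibrations :  MorphismProperty (SPre C)
  | mk {X : C} {n : ℕ} {U : Fin n → C} {K L : SSet.{u}} (i : ∀ a, U a ⟶ X)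
      (hi : ∀ a, Mono (i a)) (g : K ⟶ L) (hg : SSet.modelCategoryQuillen.J g) :
      generatingAcyclicCofibrations
        (pushoutProduct ((discrete C).map (unionMap i)) ((constant C).map g))

variable (C) in
/-- Flasque fibrations: the maps with the right lifting property with respect to `J`. -/
def flasqueFibrations : MorphismProperty (SPre C) := (generatingAcyclicCofibrations C).rlp

variable (C) in
/-- Flasque cofibrations: the maps with the left lifting property with respect to the flasque
fibrations that are objectwise weak equivalences. -/
def flasqueCofibrations : MorphismProperty (SPre C) := (flasqueFibrations C ⊓ objectwiseWeq).llp

end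

end Flasque

end

/-! All three claims are lifting statements. By the two-variable adjunctions (product with `HOM`,
tensor with `Map`), a map `j` lifts against the pullback-hom of `i` and `f` exactly when `i □ j`
lifts against `f`. It therefore suffices that `□` preserves flasque cofibrations, and that `f □ g`
lifts against every flasque fibration as soon as one factor does. Adjunction again reduces this to
generators (`hasLiftingProperty_pushoutProduct_of_saturation`).

The generators are the maps `(∪ U ⟶ X) □ g` with `g` a horn inclusion, or with `U` empty and `g` any
monomorphism. Since `C` has products, the pushout product of two of them is `(∪ W ⟶ X ⨯ Y) □ (g □
h)`, where `W` consists of the `U a ⨯ Y` and the `X ⨯ V b`; and `g □ h` is a monomorphism, anodyne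
if `g` or `h` is. For claim 3, the terminal object of `C` makes the constant presheaf on `K` a
tensor of a representable with `K`.

Two inputs make this work.

The first is that flasque fibrations which are objectwise weak equivalences are the maps lifting
against the generators (`rlp_generatingCofibrations`). For `U` empty, lifting against the generators
says that each `p(X)` lifts against monomorphisms, so a map of simplicial sets must have this
property exactly when it is a Kan fibration and a weak equivalence (`trivFib_iff`). Weak
equivalences being defined by homotopy classes of maps into Kan complexes, the hard direction is
first proved over a Kan base by Dold's argument. Over a general base `B`, choose an anodyne `B ⟶ B'`
with `B'` Kan, extend the fibration over `B'` (`fibrationExtends_of_anodyne`), and pull a section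
and a fibrewise contraction back to `B`. Fibrations extend along a horn because the horn contracts
within itself; hence a universe of Kan fibrations of bounded size is a Kan complex, and extending
classifying maps handles all anodyne maps.

The second is that flasque cofibrations which are objectwise weak equivalences are the maps lifting
against all flasque fibrations (`llp_flasqueFibrations_iff`). This follows from the small object
argument and the retract argument, once such lifting maps are known to be objectwise anodyne. -/

open Simplicial HomotopicalAlgebra SSet SSet.modelCategoryQuillen CartesianMonoidalCategory

noncomputable section

namespace Flasque

section

/-! ### Homotopies over a base -/

/-- The inclusion `X ⟶ X ⊗ Δ[1]` at the endpoint `e`. -/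
def endpt (e : Fin 2) {X : SSet.{u}} : X ⟶ X ⊗ Δ[1] :=
  lift (𝟙 X) (SSet.const (stdSimplex.obj₀Equiv.{u}.symm e))

lemma endpt_fst (e : Fin 2) (X : SSet.{u}) : endpt e ≫ fst X _ = 𝟙 X := rfl

lemma endpt_fst_assoc (e : Fin 2) {X Y : SSet.{u}} (f : X ⟶ Y) :
    endpt e ≫ fst X Δ[1] ≫ f = f := rfl

lemma endpt_comp (e : Fin 2) {X Y : SSet.{u}} (f : X ⟶ Y) : endpt e ≫ f ▷ _ = f ≫ endpt e := rfl

lemma endpt_comp_assoc (e : Fin 2) {X Y Z : SSet.{u}} (f : X ⟶ Y) (g : Y ⊗ Δ[1] ⟶ Z) :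
    endpt e ≫ f ▷ _ ≫ g = f ≫ endpt e ≫ g := rfl

lemma whiskerRight_fst_comp {X Y Z : SSet.{u}} (f : X ⟶ Y) (g : Y ⟶ Z) (W : SSet.{u}) :
    f ▷ W ≫ fst Y W ≫ g = fst X W ≫ f ≫ g := rfl

/-- A simplex of `Λ[1, e]` misses the vertex other than `e`, so all its vertices are `e`. -/
lemma horn_one_ι (e : Fin 2) :
    Λ[1, e].ι = (SSet.const (stdSimplex.obj₀Equiv.{u}.symm e) : (Λ[1, e] : SSet.{u}) ⟶ Δ[1]) := by
  ext ⟨m⟩ ⟨x, hx⟩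
  induction m using SimplexCategory.rec with | _ m
  obtain ⟨j, hj, hx⟩ := (mem_horn_iff_notMem_range x e).1 hx
  refine SSet.stdSimplex.ext _ _ fun i => ?_
  change x i = e
  have h1 : x i ≠ j := fun h => hx ⟨i, h⟩
  omega

lemma whiskerLeft_horn_one_ι (e : Fin 2) (X : SSet.{u}) :
    X ◁ Λ[1, e].ι = fst _ _ ≫ endpt e := by
  rw [horn_one_ι]; rfl

/-- Lifting against a pushout product. -/
lemma exists_lift_pushoutObjObj {C : Type*} [Category C] [MonoidalCategory C]
    {K L X Y W A : C} {i : K ⟶ L} {j : X ⟶ Y}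
    (sq : (curriedTensor C).PushoutObjObj i j) (p : W ⟶ A) (hp : HasLiftingProperty sq.ι p)
    (a : L ⊗ X ⟶ W) (b : K ⊗ Y ⟶ W) (v : L ⊗ Y ⟶ A)
    (h₁ : i ▷ X ≫ a = K ◁ j ≫ b) (h₂ : b ≫ p = i ▷ Y ≫ v) (h₃ : a ≫ p = L ◁ j ≫ v) :
    ∃ G : L ⊗ Y ⟶ W, i ▷ Y ≫ G = b ∧ L ◁ j ≫ G = a ∧ G ≫ p = v := by
  obtain ⟨d, hl, hr⟩ := sq.isPushout.exists_desc a b h₁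
  have hd : d ≫ p = sq.ι ≫ v := by
    apply sq.isPushout.hom_ext
    · rw [reassoc_of% hl, sq.inl_ι_assoc, h₃]; rfl
    · rw [reassoc_of% hr, sq.inr_ι_assoc, h₂]; rfl
  have csq : CommSq d sq.ι p v := ⟨hd⟩
  have hL := csq.fac_left
  exact ⟨csq.lift, by have := sq.inr ≫= hL; rw [sq.inr_ι_assoc, hr] at this; exact this,
    by have := sq.inl ≫= hL; rw [sq.inl_ι_assoc, hl] at this; exact this, csq.fac_right⟩

lemma one_sub_ne (e : Fin 2) : 1 - e ≠ e := by decide +revert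

/-- The homotopy extension lifting property. -/
lemma exists_homotopy_lift (e : Fin 2) {K L W A : SSet.{u}} (i : K ⟶ L) [Mono i] (p : W ⟶ A)
    [Fibration p] (u : L ⟶ W) (H : K ⊗ Δ[1] ⟶ W) (v : L ⊗ Δ[1] ⟶ A)
    (h₁ : endpt e ≫ H = i ≫ u) (h₂ : H ≫ p = i ▷ _ ≫ v) (h₃ : u ≫ p = endpt e ≫ v) :
    ∃ G : L ⊗ Δ[1] ⟶ W, i ▷ _ ≫ G = H ∧ endpt e ≫ G = u ∧ G ≫ p = v := by
  let sq := Functor.PushoutObjObj.ofHasPushout (curriedTensor SSet.{u}) i Λ[1, e].ι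
  have hsq : anodyneExtensions sq.ι :=
    anodyneExtensions_pushoutObjObjι sq (anodyneExtensions.horn_ι e)
  have hp : HasLiftingProperty sq.ι p := hsq p (by rwa [← HomotopicalAlgebra.fibration_iff])
  obtain ⟨G, hG₁, hG₂, hG₃⟩ := exists_lift_pushoutObjObj sq p hp (fst _ _ ≫ u) H v
    (by rw [whiskerLeft_horn_one_ι, Category.assoc, h₁]; rfl) h₂
    (by rw [whiskerLeft_horn_one_ι, Category.assoc, Category.assoc, h₃])
  refine ⟨G, hG₁, ?_, hG₃⟩
  -- `Λ[1, e]` is a point: composing with the section at its vertex turns the equation on `L ⊗ Λ[1,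
  -- e]` into one at the end `e`.
  let s : L ⟶ L ⊗ (Λ[1, e] : SSet.{u}) := lift (𝟙 L) (SSet.const ⟨stdSimplex.obj₀Equiv.symm e, by
    rw [mem_horn_iff_notMem_range]
    refine ⟨1 - e, one_sub_ne e, ?_⟩
    rintro ⟨i, hi⟩
    exact one_sub_ne e hi.symm⟩)
  exact congr(s ≫ $hG₂)

lemma exists_desc_tensor {T R X W : SSet.{u}} (a : T ⊗ X ⟶ W) (b : R ⊗ X ⟶ W) :
    ∃ H : (T ⨿ R) ⊗ X ⟶ W, coprod.inl ▷ X ≫ H = a ∧ coprod.inr ▷ X ≫ H = b := by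
  have h := isColimitOfHasBinaryCoproductOfPreservesColimit (tensorRight X) T R
  exact ⟨h.desc (BinaryCofan.mk a b), h.fac _ ⟨.left⟩, h.fac _ ⟨.right⟩⟩

lemma tensor_coprod_hom_ext {T R X W : SSet.{u}} {f g : (T ⨿ R) ⊗ X ⟶ W}
    (h₁ : coprod.inl ▷ X ≫ f = coprod.inl ▷ X ≫ g) (h₂ : coprod.inr ▷ X ≫ f = coprod.inr ▷ X ≫ g) :
    f = g :=
  BinaryCofan.IsColimit.hom_ext
    (isColimitOfHasBinaryCoproductOfPreservesColimit (tensorRight X) T R) h₁ h₂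

lemma mono_of_injective {X Y : SSet.{u}} (f : X ⟶ Y) (h : ∀ n, Function.Injective (f.app n)) :
    Mono f := by
  have (n : SimplexCategoryᵒᵖ) : Mono (f.app n) := (mono_iff_injective _).2 (h n)
  exact NatTrans.mono_of_mono_app _

lemma app_injective {X Y : SSet.{u}} (f : X ⟶ Y) [Mono f] (n : SimplexCategoryᵒᵖ) :
    Function.Injective (f.app n) :=
  (mono_iff_injective _).1 inferInstance

lemma coprod_cases {X Y : SSet.{u}} {n : SimplexCategoryᵒᵖ} (z : (X ⨿ Y).obj n) :
    (∃ x, (coprod.inl : X ⟶ X ⨿ Y).app n x = z) ∨ ∃ y, (coprod.inr : Y ⟶ X ⨿ Y).app n y = z := by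
  have h := isColimitOfHasBinaryCoproductOfPreservesColimit ((evaluation _ (Type u)).obj n) X Y
  have := ((Types.binaryCofan_isColimit_iff _).1 ⟨h⟩).2.2
  have hz : z ∈ (Set.univ : Set _) := Set.mem_univ z
  by_cases hx : z ∈ Set.range ((coprod.inl : X ⟶ X ⨿ Y).app n)
  · exact Or.inl hx
  · exact Or.inr (this.compl_eq.le hx)

lemma mono_coprod_desc {X Y Z : SSet.{u}} (f : X ⟶ Z) (g : Y ⟶ Z) [Mono f] [Mono g]
    (h : ∀ n (x : X.obj n) (y : Y.obj n), f.app n x ≠ g.app n y) : Mono (coprod.desc f g) := by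
  apply mono_of_injective
  have hf {n} (x : X.obj n) : (coprod.desc f g).app n ((coprod.inl : X ⟶ X ⨿ Y).app n x) =
    f.app n x := congr(($(coprod.inl_desc f g)).app n x)
  have hg {n} (x : Y.obj n) : (coprod.desc f g).app n ((coprod.inr : Y ⟶ X ⨿ Y).app n x) =
    g.app n x := congr(($(coprod.inr_desc f g)).app n x)
  intro n a b hab
  obtain ⟨a, rfl⟩ | ⟨a, rfl⟩ := coprod_cases a <;> obtain ⟨b, rfl⟩ | ⟨b, rfl⟩ := coprod_cases b
  · rw [hf, hf] at hab; rw [app_injective f n hab]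
  · rw [hf, hg] at hab; exact (h _ _ _ hab).elim
  · rw [hf, hg] at hab; exact (h _ _ _ hab.symm).elim
  · rw [hg, hg] at hab; rw [app_injective g n hab]

instance mono_endpt (e : Fin 2) (X : SSet.{u}) : Mono (endpt e : X ⟶ X ⊗ Δ[1]) :=
  mono_of_mono_fac (endpt_fst e X)

lemma endpt_app_snd (e : Fin 2) {X : SSet.{u}} {n : ℕ} (x : X _⦋n⦌) (i : Fin (n + 1)) :
    ((endpt e : X ⟶ X ⊗ Δ[1]).app _ x).2 i = e := rfl

instance mono_coprod_desc_endpt (T : SSet.{u}) :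
    Mono (coprod.desc (endpt 0) (endpt 1) : T ⨿ T ⟶ T ⊗ Δ[1]) := by
  apply mono_coprod_desc
  rintro ⟨n⟩ x y h
  induction n using SimplexCategory.rec with | _ n
  have := endpt_app_snd 0 x 0
  rw [h, endpt_app_snd] at this
  simp at this

/-- Filling of open boxes in a fibration. -/
lemma exists_box_lift (e : Fin 2) {T W A : SSet.{u}} (p : W ⟶ A) [Fibration p]
    (v : (T ⊗ Δ[1]) ⊗ Δ[1] ⟶ A) (c a₀ a₁ : T ⊗ Δ[1] ⟶ W)
    (hc : c ≫ p = endpt e ≫ v) (ha₀ : a₀ ≫ p = endpt 0 ▷ _ ≫ v) (ha₁ : a₁ ≫ p = endpt 1 ▷ _ ≫ v)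
    (h₀ : endpt e ≫ a₀ = endpt 0 ≫ c) (h₁ : endpt e ≫ a₁ = endpt 1 ≫ c) :
    ∃ G : (T ⊗ Δ[1]) ⊗ Δ[1] ⟶ W,
      endpt e ≫ G = c ∧ endpt 0 ▷ _ ≫ G = a₀ ∧ endpt 1 ▷ _ ≫ G = a₁ ∧ G ≫ p = v := by
  obtain ⟨H, hH₀, hH₁⟩ := exists_desc_tensor a₀ a₁
  -- The last factor `Δ[1]` is the homotopy coordinate: `c` is the base of the box, and `a₀`, `a₁`
  -- are the sides over the two copies of `T`.
  obtain ⟨G, hG₁, hG₂, hG₃⟩ := exists_homotopy_lift e (coprod.desc (endpt 0) (endpt 1)) p c H v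
    (by
      ext1
      · rw [← endpt_comp_assoc, hH₀, h₀, coprod.inl_desc_assoc]
      · rw [← endpt_comp_assoc, hH₁, h₁, coprod.inr_desc_assoc])
    (by
      apply tensor_coprod_hom_ext
      · rw [reassoc_of% hH₀, ha₀, ← comp_whiskerRight_assoc, coprod.inl_desc]
      · rw [reassoc_of% hH₁, ha₁, ← comp_whiskerRight_assoc, coprod.inr_desc]) hc
  refine ⟨G, hG₂, ?_, ?_, hG₃⟩
  · rw [← hH₀, ← hG₁, ← comp_whiskerRight_assoc, coprod.inl_desc]
  · rw [← hH₁, ← hG₁, ← comp_whiskerRight_assoc, coprod.inr_desc]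

/-- Two maps `f g : T ⟶ W` are homotopic over `A`, where `p : W ⟶ A`. -/
def FibHomotopic {T W A : SSet.{u}} (p : W ⟶ A) (f g : T ⟶ W) : Prop :=
  ∃ H : T ⊗ Δ[1] ⟶ W, endpt 0 ≫ H = f ∧ endpt 1 ≫ H = g ∧ H ≫ p = fst _ _ ≫ f ≫ p

namespace FibHomotopic

variable {T R W A : SSet.{u}} {p : W ⟶ A} {f g h : T ⟶ W}

lemma comp_eq (hfg : FibHomotopic p f g) : f ≫ p = g ≫ p := by
  obtain ⟨H, h₀, h₁, h₂⟩ := hfg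
  rw [← h₁, Category.assoc, h₂, endpt_fst_assoc]

lemma refl (p : W ⟶ A) (f : T ⟶ W) : FibHomotopic p f f :=
  ⟨fst _ _ ≫ f, endpt_fst_assoc _ _, endpt_fst_assoc _ _, Category.assoc _ _ _⟩

lemma trans [Fibration p] (hfg : FibHomotopic p f g) (hgh : FibHomotopic p g h) :
    FibHomotopic p f h := by
  have hfg' := hfg.comp_eq
  obtain ⟨H, h₀, h₁, h₂⟩ := hfg
  obtain ⟨K, k₀, k₁, k₂⟩ := hgh
  -- Base `H` from `f` to `g`, sides the constant homotopy at `f` and `K`; the lid runs from `f` to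
  -- `h`.
  obtain ⟨G, hG₀, hG₁, hG₂, hG₃⟩ := exists_box_lift 0 p (fst _ _ ≫ fst _ _ ≫ f ≫ p)
    H (fst _ _ ≫ f) K (by rw [h₂, endpt_fst_assoc])
    (by rw [whiskerRight_fst_comp, endpt_fst_assoc, Category.assoc])
    (by rw [k₂, ← hfg', whiskerRight_fst_comp, endpt_fst_assoc])
    (by rw [h₀, endpt_fst_assoc]) (by rw [k₀, h₁])
  refine ⟨endpt 1 ≫ G, ?_, ?_, by rw [Category.assoc, hG₃, endpt_fst_assoc]⟩
  · rw [← endpt_comp_assoc, hG₁, endpt_fst_assoc]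
  · rw [← endpt_comp_assoc, hG₂, k₁]

lemma symm [Fibration p] (hfg : FibHomotopic p f g) : FibHomotopic p g f := by
  have hfg' := hfg.comp_eq
  obtain ⟨H, h₀, h₁, h₂⟩ := hfg
  -- Base constant at `f`, sides `H` and the constant homotopy at `f`; the lid runs from `g` to `f`.
  obtain ⟨G, hG₀, hG₁, hG₂, hG₃⟩ := exists_box_lift 0 p (fst _ _ ≫ fst _ _ ≫ f ≫ p)
    (fst _ _ ≫ f) H (fst _ _ ≫ f) (by rw [endpt_fst_assoc, Category.assoc])
    (by rw [h₂, whiskerRight_fst_comp, endpt_fst_assoc])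
    (by rw [whiskerRight_fst_comp, endpt_fst_assoc, Category.assoc])
    (by rw [h₀, endpt_fst_assoc]) (by rw [endpt_fst_assoc, endpt_fst_assoc])
  refine ⟨endpt 1 ≫ G, ?_, ?_, by rw [Category.assoc, hG₃, ← hfg', endpt_fst_assoc]⟩
  · rw [← endpt_comp_assoc, hG₁, h₁]
  · rw [← endpt_comp_assoc, hG₂, endpt_fst_assoc]

lemma precomp (hfg : FibHomotopic p f g) (k : R ⟶ T) : FibHomotopic p (k ≫ f) (k ≫ g) := by
  obtain ⟨H, h₀, h₁, h₂⟩ := hfg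
  refine ⟨k ▷ _ ≫ H, ?_, ?_, ?_⟩
  · rw [endpt_comp_assoc, h₀]
  · rw [endpt_comp_assoc, h₁]
  · rw [Category.assoc, h₂, Category.assoc, whiskerRight_fst_comp]

lemma postcomp (hfg : FibHomotopic p f g) {V : SSet.{u}} {q : V ⟶ A} (k : W ⟶ V)
    (hk : k ≫ q = p) : FibHomotopic q (f ≫ k) (g ≫ k) := by
  obtain ⟨H, h₀, h₁, h₂⟩ := hfg
  refine ⟨H ≫ k, ?_, ?_, ?_⟩
  · rw [reassoc_of% h₀]
  · rw [reassoc_of% h₁]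
  · rw [Category.assoc, hk, h₂, Category.assoc, hk]

end FibHomotopic

end

/-! ### Trivial fibrations and weak equivalences of simplicial sets -/

/-- Trivial fibrations: maps with the right lifting property with respect to monomorphisms. -/
abbrev TrivFib {W P : SSet.{u}} (q : W ⟶ P) : Prop := (MorphismProperty.monomorphisms SSet.{u}).rlp q

lemma TrivFib.hasLift {W P K L : SSet.{u}} {q : W ⟶ P} (hq : TrivFib q) (i : K ⟶ L) [Mono i] :
    HasLiftingProperty i q :=
  hq i (MorphismProperty.monomorphisms.infer_property i)

lemma TrivFib.fibration {W P : SSet.{u}} {q : W ⟶ P} (hq : TrivFib q) : Fibration q := by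
  rw [fibration_iff]
  exact MorphismProperty.antitone_rlp J_le_monomorphisms _ hq

lemma TrivFib.exists_lift {W P K L : SSet.{u}} {q : W ⟶ P} (hq : TrivFib q) (i : K ⟶ L) [Mono i]
    (u : K ⟶ W) (v : L ⟶ P) (h : u ≫ q = i ≫ v) : ∃ l : L ⟶ W, i ≫ l = u ∧ l ≫ q = v := by
  have := hq.hasLift i
  have sq : CommSq u i q v := ⟨h⟩
  exact ⟨sq.lift, sq.fac_left, sq.fac_right⟩

lemma TrivFib.exists_section {W P : SSet.{u}} {q : W ⟶ P} (hq : TrivFib q) :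
    ∃ s : P ⟶ W, s ≫ q = 𝟙 P := by
  have : Mono (initial.to P) := by
    apply mono_of_injective
    intro n x
    have h := IsInitial.isInitialObj ((evaluation _ (Type u)).obj n) (⊥_ SSet.{u}) initialIsInitial
    exact ((Types.initial_iff_empty _).1 ⟨h⟩).elim x
  obtain ⟨l, _, hl⟩ := hq.exists_lift (initial.to P) (initial.to W) (𝟙 P) (by simp)
  exact ⟨l, hl⟩

/-- The constant homotopy in the base lifts relative to the two ends, since `T ⨿ T ⟶ T ⊗ Δ[1]` is a
monomorphism. -/
lemma TrivFib.fibHomotopic {W P T : SSet.{u}} {q : W ⟶ P} (hq : TrivFib q) {f g : T ⟶ W}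
    (h : f ≫ q = g ≫ q) : FibHomotopic q f g := by
  obtain ⟨l, hl, hl'⟩ := hq.exists_lift (coprod.desc (endpt 0) (endpt 1)) (coprod.desc f g)
    (fst _ _ ≫ f ≫ q) (by
      ext1
      · rw [coprod.inl_desc_assoc, coprod.inl_desc_assoc, endpt_fst_assoc]
      · rw [coprod.inr_desc_assoc, coprod.inr_desc_assoc, endpt_fst_assoc, h])
  refine ⟨l, ?_, ?_, hl'⟩
  · rw [← coprod.inl_desc (endpt 0) (endpt 1), Category.assoc, hl, coprod.inl_desc]
  · rw [← coprod.inr_desc (endpt 0) (endpt 1), Category.assoc, hl, coprod.inr_desc]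

/-- The homotopy lifting property. -/
lemma exists_homotopy_lift_of_start {R W P A : SSet.{u}} (q : W ⟶ P) [Fibration q] (π : P ⟶ A)
    (g : R ⟶ W) (k : R ⟶ P) (h : FibHomotopic π (g ≫ q) k) :
    ∃ g' : R ⟶ W, g' ≫ q = k ∧ FibHomotopic (q ≫ π) g g' := by
  obtain ⟨H, h₀, h₁, h₂⟩ := h
  have hl : HasLiftingProperty (R ◁ Λ[1, 0].ι) q :=
    (anodyneExtensions.horn_ι.{u} (0 : Fin 2)).whiskerLeft R q
      (by rwa [← HomotopicalAlgebra.fibration_iff])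
  have sq : CommSq (fst _ _ ≫ g) (R ◁ Λ[1, 0].ι) q H :=
    ⟨by rw [whiskerLeft_horn_one_ι, Category.assoc, Category.assoc, h₀]⟩
  have hf := sq.fac_left
  have hG : endpt 0 ≫ sq.lift = g := by
    let s : R ⟶ R ⊗ (Λ[1, 0] : SSet.{u}) := lift (𝟙 R) (SSet.const ⟨stdSimplex.obj₀Equiv.symm 0, by
      rw [mem_horn_iff_notMem_range]
      refine ⟨1, by decide, ?_⟩
      rintro ⟨i, hi⟩
      exact one_sub_ne 0 hi.symm⟩)
    exact congr(s ≫ $hf)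
  refine ⟨endpt 1 ≫ sq.lift, ?_, sq.lift, hG, rfl, ?_⟩
  · rw [Category.assoc, sq.fac_right, h₁]
  · rw [← Category.assoc, sq.fac_right, h₂, Category.assoc]

/-- A fibration which is fibrewise homotopy equivalent to its base is a trivial fibration. -/
lemma trivFib_of_fibHomotopic {W P : SSet.{u}} (q : W ⟶ P) [Fibration q] (g : P ⟶ W)
    (hg : g ≫ q = 𝟙 P) (h : FibHomotopic q (𝟙 W) (q ≫ g)) : TrivFib q := by
  intro K L i (hi : Mono i)
  refine ⟨fun {u v} sq => ?_⟩
  obtain ⟨H, h₀, h₁, h₂⟩ := h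
  -- `v ≫ g` solves the problem except that on `K` it is only homotopic to `u`. Extending that
  -- homotopy from its end `1` and taking the end `0` corrects it.
  obtain ⟨G, hG₁, hG₂, hG₃⟩ := exists_homotopy_lift 1 i q (v ≫ g) (u ▷ _ ≫ H) (fst _ _ ≫ v)
    (by rw [endpt_comp_assoc, h₁, sq.w_assoc])
    (by rw [Category.assoc, h₂, whiskerRight_fst_comp, whiskerRight_fst_comp, Category.id_comp,
      sq.w])
    (by rw [Category.assoc, hg, Category.comp_id, endpt_fst_assoc])
  exact ⟨⟨⟨endpt 0 ≫ G, by rw [← endpt_comp_assoc, hG₁, endpt_comp_assoc, h₀, Category.comp_id],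
    by rw [Category.assoc, hG₃, endpt_fst_assoc]⟩⟩⟩

/-- Dold's theorem: a homotopy from the identity to a section can be made fibrewise. -/
lemma fibHomotopic_of_homotopic {W P A : SSet.{u}} (q : W ⟶ P) [Fibration q] (π : W ⟶ A)
    (g : P ⟶ W) (hg : g ≫ q = 𝟙 P) (h : FibHomotopic π (𝟙 W) (q ≫ g)) :
    FibHomotopic q (𝟙 W) (q ≫ g) := by
  obtain ⟨H, h₀, h₁, -⟩ := h
  -- The box lies over `(w, s, t) ↦ q (H (w, t))`, with sides `H` and `H ≫ q ≫ g` and constant face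
  -- `q ≫ g` at `t = 1`. Its missing face `t = 0` runs from `𝟙 W` to `q ≫ g` and lies over `q w`,
  -- hence is fibrewise.
  obtain ⟨G, hG₁, hG₂, hG₃, hG₄⟩ := exists_box_lift 1 q (fst W Δ[1] ▷ Δ[1] ≫ H ≫ q)
    (fst _ _ ≫ q ≫ g) H (H ≫ q ≫ g)
    (by rw [endpt_comp_assoc, reassoc_of% h₁, hg, Category.assoc, Category.assoc, hg])
    (by rw [← comp_whiskerRight_assoc, endpt_fst, id_whiskerRight, Category.id_comp])
    (by rw [← comp_whiskerRight_assoc, endpt_fst, id_whiskerRight, Category.id_comp,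
      Category.assoc, Category.assoc, hg, Category.comp_id])
    (by rw [h₁, endpt_fst_assoc])
    (by rw [reassoc_of% h₁, endpt_fst_assoc, reassoc_of% hg])
  refine ⟨endpt 0 ≫ G, ?_, ?_, ?_⟩
  · rw [← endpt_comp_assoc, hG₂, h₀]
  · rw [← endpt_comp_assoc, hG₃, reassoc_of% h₀]
  · rw [Category.assoc, hG₄, endpt_comp_assoc, reassoc_of% h₀, Category.id_comp]

lemma trivFib_of_homotopic {W P A : SSet.{u}} (q : W ⟶ P) [Fibration q] (π : W ⟶ A)
    (g : P ⟶ W) (hg : g ≫ q = 𝟙 P) (h : FibHomotopic π (𝟙 W) (q ≫ g)) : TrivFib q :=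
  trivFib_of_fibHomotopic q g hg (fibHomotopic_of_homotopic q π g hg h)

lemma fibHomotopic_of_homotopy {K Z : SSet.{u}} {a b : K ⟶ Z} (H : SSet.Homotopy a b) :
    FibHomotopic (terminal.from Z) a b :=
  ⟨H.h, H.h₀, H.h₁, by subsingleton⟩

lemma FibHomotopic.nonempty_homotopy {K Z A : SSet.{u}} {π : Z ⟶ A} {a b : K ⟶ Z}
    (h : FibHomotopic π a b) : Nonempty (SSet.Homotopy a b) := by
  obtain ⟨H, h₀, h₁, -⟩ := h
  exact ⟨{ h := H
           h₀ := h₀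
           h₁ := h₁
           rel := by
             ext n x
             exact (x.1.2 : False).elim }⟩

lemma FibHomotopic.mk_eq {K Z A : SSet.{u}} {π : Z ⟶ A} {a b : K ⟶ Z}
    (h : FibHomotopic π a b) : (Quot.mk _ a : HomotopyClasses K Z) = Quot.mk _ b :=
  Quot.sound h.nonempty_homotopy

/-- For a Kan target, homotopy is symmetric and transitive by box filling, so generating an
equivalence relation adds nothing. -/
lemma fibHomotopic_of_mk_eq {K Z : SSet.{u}} [Fibration (terminal.from Z)] {a b : K ⟶ Z}
    (h : (Quot.mk _ a : HomotopyClasses K Z) = Quot.mk _ b) :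
    FibHomotopic (terminal.from Z) a b := by
  have := Quot.eqvGen_exact h
  induction this with
  | rel _ _ h' => exact h'.elim fibHomotopic_of_homotopy
  | refl _ => exact .refl _ _
  | symm _ _ h₁ h₁' => exact (h₁' (Quot.eqvGen_sound h₁)).symm
  | trans _ _ _ h₁ h₂ h₁' h₂' =>
    exact (h₁' (Quot.eqvGen_sound h₁)).trans (h₂' (Quot.eqvGen_sound h₂))

lemma fibration_terminal_from (Z : SSet.{u}) (hZ : SSet.KanComplex Z) :
    Fibration (terminal.from Z) := (isFibrant_iff _).1 hZ

/-- A fibration between Kan complexes which is a weak equivalence is a trivial fibration. -/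
lemma trivFib_of_kanComplex {W P : SSet.{u}} (q : W ⟶ P) [Fibration q] (hP : SSet.KanComplex P)
    (hq : weakEquivalences q) : TrivFib q := by
  have hP' := fibration_terminal_from P hP
  have hW : SSet.KanComplex W := isFibrant_of_fibration q
  have hW' := fibration_terminal_from W hW
  -- Surjectivity on classes of maps into `W` gives a one-sided homotopy inverse; injectivity on
  -- classes of maps into `P` makes it two-sided.
  obtain ⟨⟨g₀⟩, hg₀⟩ := (hq W hW).2 (Quot.mk _ (𝟙 W))
  have h₁ : FibHomotopic (terminal.from W) (q ≫ g₀) (𝟙 W) := fibHomotopic_of_mk_eq hg₀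
  have h₂ : (Quot.mk _ (g₀ ≫ q) : HomotopyClasses P P) = Quot.mk _ (𝟙 P) := by
    apply (hq P hP).1
    have := (h₁.postcomp q (q := terminal.from P) (by subsingleton)).mk_eq
    rw [Category.id_comp] at this
    change (Quot.mk _ (q ≫ g₀ ≫ q) : HomotopyClasses W P) = Quot.mk _ (q ≫ 𝟙 P)
    rw [Category.comp_id, ← this, Category.assoc]
  -- Lifting the homotopy `g₀ ≫ q ∼ 𝟙 P` deforms `g₀` into a strict section, to which Dold's theorem
  -- applies.
  obtain ⟨g, hg, hgg⟩ := exists_homotopy_lift_of_start q _ g₀ (𝟙 P) (fibHomotopic_of_mk_eq h₂)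
  have e : q ≫ terminal.from P = terminal.from W := by subsingleton
  rw [e] at hgg
  exact trivFib_of_homotopic q (terminal.from W) g hg (h₁.symm.trans (hgg.precomp q))

/-! #### Closure properties of weak equivalences -/

lemma weakEquivalences_comp {K L M : SSet.{u}} {f : K ⟶ L} {g : L ⟶ M}
    (hf : weakEquivalences f) (hg : weakEquivalences g) : weakEquivalences (f ≫ g) := by
  intro Z hZ
  have : HomotopyClasses.precomp (f ≫ g) Z =
      HomotopyClasses.precomp f Z ∘ HomotopyClasses.precomp g Z := by
    ext ⟨a⟩
    exact congr_arg (Quot.mk _) (Category.assoc _ _ _)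
  rw [this]
  exact (hf Z hZ).comp (hg Z hZ)

lemma weakEquivalences_of_precomp {K L M : SSet.{u}} {f : K ⟶ L} {g : L ⟶ M}
    (hf : weakEquivalences f) (hfg : weakEquivalences (f ≫ g)) : weakEquivalences g := by
  intro Z hZ
  have : HomotopyClasses.precomp (f ≫ g) Z =
      HomotopyClasses.precomp f Z ∘ HomotopyClasses.precomp g Z := by
    ext ⟨a⟩
    exact congr_arg (Quot.mk _) (Category.assoc _ _ _)
  have h := hfg Z hZ
  rw [this] at h
  exact (Function.Bijective.of_comp_iff' (hf Z hZ) _).1 h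

/-- A section exists by lifting against `∅ ⟶ P`, and it is a homotopy inverse. -/
lemma TrivFib.weakEquivalences {W P : SSet.{u}} {q : W ⟶ P} (hq : TrivFib q) :
    weakEquivalences q := by
  obtain ⟨s, hs⟩ := hq.exists_section
  have h : FibHomotopic q (q ≫ s) (𝟙 W) := hq.fibHomotopic (by simp [hs])
  obtain ⟨H⟩ := h.nonempty_homotopy
  intro Z _
  refine ⟨?_, ?_⟩
  · rintro ⟨a⟩ ⟨b⟩ hab
    have := congr_arg (HomotopyClasses.precomp s Z) hab
    change (Quot.mk _ (s ≫ q ≫ a) : HomotopyClasses P Z) = Quot.mk _ (s ≫ q ≫ b) at this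
    rwa [reassoc_of% hs, reassoc_of% hs] at this
  · rintro ⟨a⟩
    refine ⟨Quot.mk _ (s ≫ a), ?_⟩
    change (Quot.mk _ (q ≫ s ≫ a) : HomotopyClasses W Z) = _
    have h' : FibHomotopic (terminal.from W) (q ≫ s) (𝟙 W) :=
      fibHomotopic_of_homotopy H
    have h'' := (h'.postcomp (q := terminal.from Z) a (by subsingleton)).mk_eq
    rwa [Category.id_comp, Category.assoc] at h''

/-! ### Homotopies with both ends prescribed, and anodyne extensions as weak equivalences -/

/-- The inclusion of the endpoints of `Δ[1]`. -/
def endpts : 𝟙_ SSet.{u} ⨿ 𝟙_ SSet.{u} ⟶ Δ[1] :=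
  coprod.desc (SSet.const (stdSimplex.obj₀Equiv.symm 0)) (SSet.const (stdSimplex.obj₀Equiv.symm 1))

instance mono_const (e : Fin 2) :
    Mono (SSet.const (stdSimplex.obj₀Equiv.symm e) : 𝟙_ SSet.{u} ⟶ Δ[1]) := by
  apply mono_of_injective
  rintro n ⟨⟩ ⟨⟩ _
  rfl

instance mono_endpts : Mono endpts.{u} := by
  apply mono_coprod_desc
  rintro ⟨n⟩ x y h
  induction n using SimplexCategory.rec with | _ n
  replace h : (SSet.const (X := 𝟙_ SSet.{u}) (stdSimplex.obj₀Equiv.symm 0)).app (op ⦋n⦌) x 0 =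
    (SSet.const (X := 𝟙_ SSet.{u}) (stdSimplex.obj₀Equiv.symm 1)).app (op ⦋n⦌) y 0 :=
    congr($h (0 : Fin (n + 1)))
  replace h : (0 : Fin 2) = 1 := h
  simp at h

/-- A homotopy on `K` and both ends on `L` together form a map out of the source of `i □ endpts`; a
lift against `p` is the extended homotopy. -/
lemma exists_relative_homotopy_lift {K L W A : SSet.{u}} (i : K ⟶ L) (p : W ⟶ A)
    (hp : HasLiftingProperty
      (Functor.PushoutObjObj.ofHasPushout (curriedTensor SSet.{u}) i endpts).ι p)
    (f g : L ⟶ W) (H : K ⊗ Δ[1] ⟶ W) (v : L ⊗ Δ[1] ⟶ A)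
    (h₀ : endpt 0 ≫ H = i ≫ f) (h₁ : endpt 1 ≫ H = i ≫ g) (h : H ≫ p = i ▷ _ ≫ v)
    (hf : f ≫ p = endpt 0 ≫ v) (hg : g ≫ p = endpt 1 ≫ v) :
    ∃ G : L ⊗ Δ[1] ⟶ W, i ▷ _ ≫ G = H ∧ endpt 0 ≫ G = f ∧ endpt 1 ≫ G = g ∧ G ≫ p = v := by
  have hT (T : SSet.{u}) := isColimitOfHasBinaryCoproductOfPreservesColimit (tensorLeft T)
    (𝟙_ SSet.{u}) (𝟙_ SSet.{u})
  obtain ⟨a, ha₀, ha₁⟩ : ∃ a : L ⊗ (𝟙_ SSet.{u} ⨿ 𝟙_ SSet.{u}) ⟶ W,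
      L ◁ coprod.inl ≫ a = (ρ_ L).hom ≫ f ∧ L ◁ coprod.inr ≫ a = (ρ_ L).hom ≫ g :=
    ⟨(hT L).desc (BinaryCofan.mk ((ρ_ L).hom ≫ f) ((ρ_ L).hom ≫ g)),
      (hT L).fac _ ⟨.left⟩, (hT L).fac _ ⟨.right⟩⟩
  have e₀ (T : SSet.{u}) : T ◁ coprod.inl ≫ T ◁ endpts = (ρ_ T).hom ≫ endpt 0 := by
    rw [← MonoidalCategory.whiskerLeft_comp, endpts, coprod.inl_desc]; rfl
  have e₁ (T : SSet.{u}) : T ◁ coprod.inr ≫ T ◁ endpts = (ρ_ T).hom ≫ endpt 1 := by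
    rw [← MonoidalCategory.whiskerLeft_comp, endpts, coprod.inr_desc]; rfl
  obtain ⟨G, hG₁, hG₂, hG₃⟩ := exists_lift_pushoutObjObj _ p hp a H v
    (by
      apply BinaryCofan.IsColimit.hom_ext (hT K)
      · change K ◁ coprod.inl ≫ _ = K ◁ coprod.inl ≫ _
        rw [whisker_exchange_assoc, ha₀, reassoc_of% (e₀ K), h₀]; rfl
      · change K ◁ coprod.inr ≫ _ = K ◁ coprod.inr ≫ _
        rw [whisker_exchange_assoc, ha₁, reassoc_of% (e₁ K), h₁]; rfl) h
    (by
      apply BinaryCofan.IsColimit.hom_ext (hT L)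
      · change L ◁ coprod.inl ≫ _ = L ◁ coprod.inl ≫ _
        rw [reassoc_of% ha₀, reassoc_of% (e₀ L), hf]
      · change L ◁ coprod.inr ≫ _ = L ◁ coprod.inr ≫ _
        rw [reassoc_of% ha₁, reassoc_of% (e₁ L), hg])
  refine ⟨G, hG₁, ?_, ?_, hG₃⟩
  · rw [← hG₂, reassoc_of% (e₀ L), Iso.cancel_iso_hom_left] at ha₀
    exact ha₀
  · rw [← hG₂, reassoc_of% (e₁ L), Iso.cancel_iso_hom_left] at ha₁
    exact ha₁

lemma hasLiftingProperty_of_anodyne {K L W A : SSet.{u}} {i : K ⟶ L}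
    (hi : anodyneExtensions i) (p : W ⟶ A) [Fibration p] : HasLiftingProperty i p :=
  hi p ((HomotopicalAlgebra.fibration_iff _).1 inferInstance)

lemma hasLiftingProperty_pushoutProduct_of_anodyne {K L W A : SSet.{u}} {i : K ⟶ L}
    (hi : anodyneExtensions i) (p : W ⟶ A) [Fibration p] : HasLiftingProperty
      (Functor.PushoutObjObj.ofHasPushout (curriedTensor SSet.{u}) i endpts).ι p :=
  hasLiftingProperty_of_anodyne (anodyneExtensions_pushoutObjObjι' _ hi) p

lemma exists_of_isPushout {D : Type*} [Category D] {A B B' P : D} {f : A ⟶ B} {g : A ⟶ B'}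
    {inl : B ⟶ P} {inr : B' ⟶ P} (h : IsPushout f g inl inr) (F : D ⥤ Type u)
    [PreservesColimit (span f g) F] (z : F.obj P) :
    (∃ x, F.map inl x = z) ∨ ∃ y, F.map inr y = z :=
  Types.eq_or_eq_of_isPushout (h.map F) z

lemma mono_pushoutObjObj_ι {K L X Y : SSet.{u}} {i : K ⟶ L} {j : X ⟶ Y} [Mono i] [Mono j]
    (sq : (curriedTensor SSet.{u}).PushoutObjObj i j) : Mono sq.ι := by
  apply mono_of_injective
  have hl (n) (l : L.obj n) (x : X.obj n) : sq.ι.app n (sq.inl.app n (l, x)) = (l, j.app n x) :=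
    congr(($(sq.inl_ι)).app n (l, x))
  have hr (n) (k : K.obj n) (y : Y.obj n) : sq.ι.app n (sq.inr.app n (k, y)) = (i.app n k, y) :=
    congr(($(sq.inr_ι)).app n (k, y))
  have hw (n) (k : K.obj n) (x : X.obj n) : sq.inl.app n (i.app n k, x) =
    sq.inr.app n (k, j.app n x) := congr(($(sq.isPushout.w)).app n (k, x))
  intro n a b hab
  obtain ⟨⟨l, x⟩, rfl⟩ | ⟨⟨k, y⟩, rfl⟩ :=
    exists_of_isPushout sq.isPushout ((evaluation _ (Type u)).obj n) a <;>
  obtain ⟨⟨l', x'⟩, rfl⟩ | ⟨⟨k', y'⟩, rfl⟩ :=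
    exists_of_isPushout sq.isPushout ((evaluation _ (Type u)).obj n) b
  · replace hab : (l, j.app n x) = (l', j.app n x') := (hl _ _ _).symm.trans (hab.trans (hl _ _ _))
    rw [Prod.mk.injEq] at hab
    rw [hab.1, app_injective j n hab.2]
  · replace hab : (l, j.app n x) = (i.app n k', y') := (hl _ _ _).symm.trans (hab.trans (hr _ _ _))
    rw [Prod.mk.injEq] at hab
    rw [hab.1, ← hab.2]
    exact hw _ _ _
  · replace hab : (i.app n k, y) = (l', j.app n x') := (hr _ _ _).symm.trans (hab.trans (hl _ _ _))
    rw [Prod.mk.injEq] at hab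
    rw [← hab.1, hab.2]
    exact (hw _ _ _).symm
  · replace hab : (i.app n k, y) = (i.app n k', y') :=
      (hr _ _ _).symm.trans (hab.trans (hr _ _ _))
    rw [Prod.mk.injEq] at hab
    rw [hab.2, app_injective i n hab.1]

lemma TrivFib.hasLiftingProperty_pushoutProduct {K L W A : SSet.{u}} (i : K ⟶ L) [Mono i]
    {p : W ⟶ A} (hp : TrivFib p) : HasLiftingProperty
      (Functor.PushoutObjObj.ofHasPushout (curriedTensor SSet.{u}) i endpts).ι p :=
  have := mono_pushoutObjObj_ι (Functor.PushoutObjObj.ofHasPushout (curriedTensor SSet.{u}) i endpts)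
  hp.hasLift _

/-- Extending maps along `i` gives surjectivity. Injectivity is extension of homotopies with
prescribed ends, possible because `i □ endpts` is again anodyne. -/
lemma anodyneExtensions.weakEquivalences {K L : SSet.{u}} {i : K ⟶ L}
    (hi : anodyneExtensions i) : weakEquivalences i := by
  intro Z hZ
  have hZ' := fibration_terminal_from Z hZ
  have hl := hasLiftingProperty_of_anodyne hi (terminal.from Z)
  refine ⟨?_, ?_⟩
  · rintro ⟨a⟩ ⟨b⟩ hab
    obtain ⟨H, h₀, h₁, -⟩ := fibHomotopic_of_mk_eq (a := i ≫ a) (b := i ≫ b) hab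
    obtain ⟨G, -, hG₀, hG₁, -⟩ := exists_relative_homotopy_lift i (terminal.from Z)
      (hasLiftingProperty_pushoutProduct_of_anodyne hi _) a b H (terminal.from _) h₀ h₁
      (by subsingleton) (by subsingleton) (by subsingleton)
    exact FibHomotopic.mk_eq (π := terminal.from Z) ⟨G, hG₀, hG₁, by subsingleton⟩
  · rintro ⟨a⟩
    have sq : CommSq a i (terminal.from Z) (terminal.from _) := ⟨by subsingleton⟩
    exact ⟨Quot.mk _ sq.lift, congr_arg (Quot.mk _) sq.fac_left⟩

/-! ### Elementwise criteria -/

lemma isPullback_of_exists {P X Y Z : SSet.{u}} {t : P ⟶ X} {l : P ⟶ Y} {r : X ⟶ Z} {b : Y ⟶ Z}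
    [Mono b] [Mono t] (w : t ≫ r = l ≫ b)
    (h : ∀ n (x : X.obj n) (y : Y.obj n), r.app n x = b.app n y → ∃ p, t.app n p = x) :
    IsPullback t l r b := by
  let φ : P ⟶ pullback r b := pullback.lift t l w
  have hφ : φ ≫ pullback.fst r b = t := pullback.lift_fst _ _ _
  have hm : Mono φ := mono_of_mono_fac hφ
  have (n : SimplexCategoryᵒᵖ) : IsIso (φ.app n) := by
    rw [isIso_iff_bijective]
    refine ⟨app_injective φ n, fun z => ?_⟩
    obtain ⟨p, hp⟩ := h n ((pullback.fst r b).app n z) ((pullback.snd r b).app n z)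
      congr(($(pullback.condition (f := r) (g := b))).app n z)
    refine ⟨p, app_injective (pullback.fst r b) n ?_⟩
    rw [← hp]
    exact congr(($hφ).app n p)
  have : IsIso φ := NatIso.isIso_of_isIso_app _
  exact IsPullback.of_iso_pullback ⟨w⟩ (asIso φ) hφ (pullback.lift_snd _ _ _)

lemma exists_of_isPullback {P X Y Z : SSet.{u}} {t : P ⟶ X} {l : P ⟶ Y} {r : X ⟶ Z} {b : Y ⟶ Z}
    (h : IsPullback t l r b) {n} (x : X.obj n) (y : Y.obj n) (hxy : r.app n x = b.app n y) :
    ∃ p, t.app n p = x ∧ l.app n p = y :=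
  Types.exists_of_isPullback (h.map ((evaluation _ (Type u)).obj n)) x y hxy

/-- Gluing of maps defined on cylinders. -/
lemma exists_glue_tensor {X W Y E D Z : SSet.{u}} (j : X ⟶ W) (t : X ⟶ Y) (a : W ⟶ E) (b : Y ⟶ E)
    [Mono a] [Mono b] (w : j ≫ a = t ≫ b)
    (hab : ∀ n (x : W.obj n) (y : Y.obj n), a.app n x = b.app n y →
      ∃ z, j.app n z = x ∧ t.app n z = y)
    (f : W ⊗ D ⟶ Z) (g : Y ⊗ D ⟶ Z) (hfg : j ▷ D ≫ f = t ▷ D ≫ g) :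
    ∃ (K : SSet.{u}) (κ : K ⟶ E) (wK : W ⟶ K) (yK : Y ⟶ K) (h : K ⊗ D ⟶ Z), Mono κ ∧
      wK ≫ κ = a ∧ yK ≫ κ = b ∧ wK ▷ D ≫ h = f ∧ yK ▷ D ≫ h = g ∧
      ∀ {V : SSet.{u}} (f g : K ⊗ D ⟶ V), wK ▷ D ≫ f = wK ▷ D ≫ g →
        yK ▷ D ≫ f = yK ▷ D ≫ g → f = g := by
  have hP := IsPushout.of_hasPushout j t
  -- Tensoring with `D` preserves the pushout, so the two cylinder maps glue. The pushout embeds in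
  -- `E` because, by `hab`, `W` and `Y` meet only in `X`.
  have hP' : IsPushout (j ▷ D) (t ▷ D) (pushout.inl j t ▷ D) (pushout.inr j t ▷ D) :=
    hP.map (tensorRight D)
  obtain ⟨h, h₁, h₂⟩ := hP'.exists_desc f g hfg
  refine ⟨pushout j t, pushout.desc a b w, pushout.inl _ _, pushout.inr _ _, h, ?_,
    pushout.inl_desc _ _ _, pushout.inr_desc _ _ _, h₁, h₂, fun _ _ => hP'.hom_ext⟩
  apply mono_of_injective
  have hl {n} (x : W.obj n) : (pushout.desc a b w).app n ((pushout.inl j t).app n x) = a.app n x :=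
    congr(($(pushout.inl_desc a b w)).app n x)
  have hr {n} (x : Y.obj n) : (pushout.desc a b w).app n ((pushout.inr j t).app n x) = b.app n x :=
    congr(($(pushout.inr_desc a b w)).app n x)
  have hw {n} (x : X.obj n) : (pushout.inl j t).app n (j.app n x) =
    (pushout.inr j t).app n (t.app n x) := congr(($(pushout.condition (f := j) (g := t))).app n x)
  intro n z z' hzz
  obtain ⟨x, rfl⟩ | ⟨x, rfl⟩ :=
    exists_of_isPushout hP ((evaluation _ (Type u)).obj n) z <;>
  obtain ⟨y, rfl⟩ | ⟨y, rfl⟩ :=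
    exists_of_isPushout hP ((evaluation _ (Type u)).obj n) z'
  · replace hzz : a.app n x = a.app n y := (hl _).symm.trans (hzz.trans (hl _))
    rw [app_injective a n hzz]
  · replace hzz : a.app n x = b.app n y := (hl _).symm.trans (hzz.trans (hr _))
    obtain ⟨z, rfl, rfl⟩ := hab n x y hzz
    exact hw z
  · replace hzz : b.app n x = a.app n y := (hr _).symm.trans (hzz.trans (hl _))
    obtain ⟨z, rfl, rfl⟩ := hab n y x hzz.symm
    exact (hw z).symm
  · replace hzz : b.app n x = b.app n y := (hr _).symm.trans (hzz.trans (hr _))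
    rw [app_injective b n hzz]

/-! ### Cofree simplicial sets -/

/-- The simplicial set with `Hom(X, cofree S) = ∏ₘ (Xₘ → S)`. -/
def cofree (S : Type u) : SSet.{u} where
  obj n := (m : SimplexCategory) → (m ⟶ n.unop) → S
  map f := ↾fun x m φ => x m (φ ≫ f.unop)
  map_id n := by ext x m φ; exact congr_arg (x m) (Category.comp_id φ)
  map_comp f g := by ext x m φ; exact congr_arg (x m) (Category.assoc φ g.unop f.unop).symm

/-- The map to a cofree simplicial set induced by a labelling of the simplices. -/
def cofreeLift {X : SSet.{u}} {S : Type u} (c : ∀ m, X.obj m → S) : X ⟶ cofree S where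
  app n := ↾fun x m φ => c (op m) (X.map φ.op x)
  naturality n n' f := by
    ext x; funext m φ
    exact congr_arg (c (op m)) (congr(($(X.map_comp f φ.op)) x)).symm

/-- The labelling of the simplices given by a map to a cofree simplicial set. -/
def cofreeLabel {X : SSet.{u}} {S : Type u} (f : X ⟶ cofree S) (m : SimplexCategoryᵒᵖ) (x : X.obj m) :
    S := f.app m x m.unop (𝟙 _)

lemma cofreeLabel_cofreeLift {X : SSet.{u}} {S : Type u} (c : ∀ m, X.obj m → S) (m) (x : X.obj m) :
    cofreeLabel (cofreeLift c) m x = c m x :=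
  congr_arg (c m) (congr(($(X.map_id m)) x))

lemma cofree_hom_ext {X : SSet.{u}} {S : Type u} {f g : X ⟶ cofree S}
    (h : ∀ m x, cofreeLabel f m x = cofreeLabel g m x) : f = g := by
  have key (f : X ⟶ cofree S) (n) (x : X.obj n) (m) (φ : m ⟶ n.unop) :
      f.app n x m φ = cofreeLabel f (op m) (X.map φ.op x) := by
    have := congr($(congr(($(f.naturality φ.op)) x)) m (𝟙 m))
    exact ((congr_arg (f.app n x m) (Category.id_comp φ)).symm.trans this.symm)
  ext n x
  funext m φ
  exact (key f n x m φ).trans ((h _ _).trans (key g n x m φ).symm)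

lemma cofreeLabel_comp {X Y : SSet.{u}} {S : Type u} (i : X ⟶ Y) (f : Y ⟶ cofree S) (m) (x : X.obj m) :
    cofreeLabel (i ≫ f) m x = cofreeLabel f m (i.app m x) := rfl

/-- A map to `cofree S` is an arbitrary labelling of simplices, so labels off the image of `i` can
be chosen freely. The control by `d` is used to make labellings injective. -/
lemma exists_extension_cofree {K L : SSet.{u}} {S : Type u} (i : K ⟶ L) [Mono i]
    (f : K ⟶ cofree S) (d : ∀ m, L.obj m → S) :
    ∃ g : L ⟶ cofree S, i ≫ g = f ∧
      ∀ m (x : L.obj m), x ∉ Set.range (i.app m) → cofreeLabel g m x = d m x := by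
  classical
  let c (m) (x : L.obj m) : S := if h : ∃ y, i.app m y = x then cofreeLabel f m h.choose else d m x
  refine ⟨cofreeLift c, cofree_hom_ext fun m x => ?_, fun m x hx => ?_⟩
  · have h : ∃ y, i.app m y = i.app m x := ⟨x, rfl⟩
    rw [cofreeLabel_comp, cofreeLabel_cofreeLift]
    simp only [c, dif_pos h]
    rw [app_injective i m h.choose_spec]
  · rw [cofreeLabel_cofreeLift]
    exact dif_neg hx

lemma trivFib_fst_cofree (X : SSet.{u}) (S : Type u) [Nonempty S] : TrivFib (fst X (cofree S)) := by
  intro K L i (hi : Mono i)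
  refine ⟨fun {u v} sq => ?_⟩
  obtain ⟨g, hg, -⟩ := exists_extension_cofree i (u ≫ snd _ _) fun _ _ => Classical.arbitrary S
  refine ⟨⟨⟨lift v g, ?_, by simp⟩⟩⟩
  ext1
  · simpa using sq.w.symm
  · simpa using hg

/-- Every map factors as a monomorphism followed by a trivial fibration. -/
lemma exists_mono_trivFib {X Y : SSet.{u}} (f : X ⟶ Y) :
    ∃ (V : SSet.{u}) (i : X ⟶ V) (q : V ⟶ Y), Mono i ∧ TrivFib q ∧ i ≫ q = f := by
  -- Each simplex is labelled by itself; `Option` keeps the set of labels nonempty when `X` is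
  -- empty.
  let l : X ⟶ cofree (Option (Σ n, X.obj n)) := cofreeLift fun m x => some ⟨m, x⟩
  have : Mono l := by
    apply mono_of_injective
    intro n x y hxy
    have h : cofreeLabel l n x = cofreeLabel l n y := congr($hxy _ (𝟙 _))
    rw [cofreeLabel_cofreeLift, cofreeLabel_cofreeLift] at h
    simpa using h
  exact ⟨_, lift f l, fst _ _, mono_of_mono_fac (lift_snd f l), trivFib_fst_cofree _ _, by simp⟩

/-! ### Extension of retracts -/

/-- If `X` is a strong deformation retract over `A` of the restriction `W` of a fibration `E ⟶ B`
along a monomorphism `A ⟶ B`, then `X` extends to a retract of `E` over `B`. -/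
lemma exists_retract_extension {A B E W X : SSet.{u}} {m : A ⟶ B} [Mono m] {e : E ⟶ B}
    [Fibration e] {tW : W ⟶ E} {w : W ⟶ A} (hW : IsPullback tW w e m) (j : X ⟶ W) [Mono j]
    (r : W ⟶ X) (H : W ⊗ Δ[1] ⟶ W) (h₀ : endpt 0 ≫ H = 𝟙 W) (h₁ : endpt 1 ≫ H = r ≫ j)
    (hw : H ≫ w = fst _ _ ≫ w) (hj : j ▷ _ ≫ H = fst _ _ ≫ j) :
    ∃ (Y : SSet.{u}) (ι : Y ⟶ E) (ρ : E ⟶ Y) (t : X ⟶ Y), ι ≫ ρ = 𝟙 Y ∧ ρ ≫ ι ≫ e = e ∧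
      IsPullback t (j ≫ w) (ι ≫ e) m := by
  have : Mono tW := MorphismProperty.of_isPullback (P := MorphismProperty.monomorphisms _)
    hW.flip (MorphismProperty.monomorphisms.infer_property m)
  -- The largest subcomplex of `E` meeting `W` in `X` only.
  let Y : E.Subcomplex :=
    { obj n := Set.ofPred fun x => ∀ (n' : SimplexCategoryᵒᵖ) (f : n ⟶ n') (z : W.obj n'),
        tW.app n' z = E.map f x → z ∈ Set.range (j.app n')
      map {n n'} f x hx n'' g z hz := hx n'' (f ≫ g) z (by rw [hz]; simp) }
  let t : X ⟶ Y := Subcomplex.lift (j ≫ tW) (by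
    rintro n _ ⟨x, rfl⟩ n' f z hz
    refine ⟨X.map f x, app_injective tW n' ?_⟩
    rw [hz]
    exact congr(($((j ≫ tW).naturality f)) x))
  have ht : t ≫ Y.ι = j ≫ tW := rfl
  have hY (n) (x : W.obj n) (y : (Y : SSet.{u}).obj n) (hxy : tW.app n x = Y.ι.app n y) :
      ∃ z, j.app n z = x ∧ t.app n z = y := by
    obtain ⟨z, hz⟩ := y.2 n (𝟙 n) x (by rw [hxy]; simp)
    refine ⟨z, hz, app_injective Y.ι n ?_⟩
    rw [← hxy, ← hz]
    exact congr(($ht).app n z)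
  -- On `W ∪ Y` the deformation is `H` on `W` and constant on `Y`. It is then extended to `E` over
  -- `B`, starting at the identity; its end `ρ₀` is the retraction.
  obtain ⟨K, κ, wK, yK, h, hκ, hwK, hyK, hh₁, hh₂, hext⟩ := exists_glue_tensor (D := Δ[1]) j t tW Y.ι
    ht.symm hY (H ≫ tW) (fst _ _ ≫ Y.ι)
    (by rw [reassoc_of% hj, whiskerRight_fst_comp, ht])
  have hwK' {V : SSet.{u}} (f : E ⊗ Δ[1] ⟶ V) : wK ▷ Δ[1] ≫ κ ▷ Δ[1] ≫ f = tW ▷ Δ[1] ≫ f := by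
    rw [← comp_whiskerRight_assoc, hwK]
  have hyK' {V : SSet.{u}} (f : E ⊗ Δ[1] ⟶ V) : yK ▷ Δ[1] ≫ κ ▷ Δ[1] ≫ f = Y.ι ▷ Δ[1] ≫ f := by
    rw [← comp_whiskerRight_assoc, hyK]
  obtain ⟨G, hG₁, hG₂, hG₃⟩ := exists_homotopy_lift 0 κ e (𝟙 E) h (fst _ _ ≫ e)
    (by
      rw [Category.comp_id]
      have hw' : wK ≫ endpt 0 ≫ h = wK ≫ κ := by
        rw [← endpt_comp_assoc, hh₁, reassoc_of% h₀, hwK]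
      have hy' : yK ≫ endpt 0 ≫ h = yK ≫ κ := by
        rw [← endpt_comp_assoc, hh₂, endpt_fst_assoc, hyK]
      have := hext (fst _ _ ≫ endpt 0 ≫ h) (fst _ _ ≫ κ)
        (by rw [whiskerRight_fst_comp, whiskerRight_fst_comp, hw'])
        (by rw [whiskerRight_fst_comp, whiskerRight_fst_comp, hy'])
      rw [← endpt_fst_assoc 0 (endpt 0 ≫ h), this, endpt_fst_assoc])
    (by
      apply hext
      · rw [reassoc_of% hh₁, hwK', whiskerRight_fst_comp, hW.w, reassoc_of% hw]
      · rw [reassoc_of% hh₂, hyK', whiskerRight_fst_comp])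
    (by rw [Category.id_comp, endpt_fst_assoc])
  let ρ₀ : E ⟶ E := endpt 1 ≫ G
  have hρe : ρ₀ ≫ e = e := by rw [Category.assoc, hG₃, endpt_fst_assoc]
  have hρW : tW ≫ ρ₀ = r ≫ j ≫ tW := by
    rw [← endpt_comp_assoc, ← hwK', hG₁, hh₁, reassoc_of% h₁]
  have hρY : Y.ι ≫ ρ₀ = Y.ι := by
    rw [← endpt_comp_assoc, ← hyK', hG₁, hh₂, endpt_fst_assoc]
  -- If a simplex of the image of `ρ₀` lies in `W`, its source lies over `A` too, hence in `W`,
  -- where `ρ₀` is the retraction onto `X`.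
  have hρ : Subcomplex.range ρ₀ ≤ Y := by
    rintro n _ ⟨x, rfl⟩ n' f z hz
    have hz' : tW.app n' z = ρ₀.app n' (E.map f x) :=
      hz.trans (congr(($(ρ₀.naturality f)) x)).symm
    obtain ⟨z', hz'', -⟩ := exists_of_isPullback hW (E.map f x) (w.app n' z) (by
      have h₁ : e.app n' (ρ₀.app n' (E.map f x)) = e.app n' (E.map f x) :=
        congr(($hρe).app n' (E.map f x))
      rw [← h₁, ← hz']
      exact congr(($(hW.w)).app n' z))
    refine ⟨r.app n' z', app_injective tW n' ?_⟩
    rw [hz', ← hz'']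
    exact (congr(($hρW).app n' z')).symm
  have : Mono (t ≫ Y.ι) := by rw [ht]; infer_instance
  have : Mono t := mono_of_mono t Y.ι
  refine ⟨Y, Y.ι, Subcomplex.lift ρ₀ hρ, t, ?_, hρe, ?_⟩
  · rw [← cancel_mono Y.ι]
    exact hρY
  · refine isPullback_of_exists (by rw [reassoc_of% ht, hW.w, Category.assoc]) fun n y a hya => ?_
    obtain ⟨z, hz, -⟩ := exists_of_isPullback hW (Y.ι.app n y) a hya
    obtain ⟨x, -, hx⟩ := hY n z y hz
    exact ⟨x, hx⟩

/-! ### Extension of fibrations along homotopy equivalences -/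

/-- Lifting `𝟙 X` along `j` gives the retraction `r`; the homotopy has prescribed ends `𝟙 W` and `r
≫ j` and is prescribed to be constant on `X`. -/
lemma exists_deformation_retraction {X W A : SSet.{u}} (j : X ⟶ W) (w : W ⟶ A)
    (h₁ : HasLiftingProperty j (j ≫ w)) (h₂ : HasLiftingProperty
      (Functor.PushoutObjObj.ofHasPushout (curriedTensor SSet.{u}) j endpts).ι w) :
    ∃ (r : W ⟶ X) (H : W ⊗ Δ[1] ⟶ W), r ≫ j ≫ w = w ∧ endpt 0 ≫ H = 𝟙 W ∧ endpt 1 ≫ H = r ≫ j ∧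
      H ≫ w = fst _ _ ≫ w ∧ j ▷ _ ≫ H = fst _ _ ≫ j := by
  have sq : CommSq (𝟙 X) j (j ≫ w) w := ⟨by simp⟩
  have hr : j ≫ sq.lift = 𝟙 X := sq.fac_left
  have hr' : sq.lift ≫ j ≫ w = w := sq.fac_right
  obtain ⟨G, hG₁, hG₂, hG₃, hG₄⟩ := exists_relative_homotopy_lift j w h₂ (𝟙 W) (sq.lift ≫ j)
    (fst _ _ ≫ j) (fst _ _ ≫ w) (by rw [endpt_fst_assoc, Category.comp_id])
    (by rw [endpt_fst_assoc, reassoc_of% hr])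
    (by rw [whiskerRight_fst_comp, Category.assoc])
    (by rw [endpt_fst_assoc, Category.id_comp]) (by rw [endpt_fst_assoc, Category.assoc, hr'])
  exact ⟨sq.lift, G, hr', hG₂, hG₃, hG₄, hG₁⟩

lemma fibration_of_isPullback {P X Y Z : SSet.{u}} {t : P ⟶ X} {l : P ⟶ Y} {r : X ⟶ Z} {b : Y ⟶ Z}
    (h : IsPullback t l r b) [hr : Fibration r] : Fibration l := by
  rw [fibration_iff] at hr ⊢
  exact MorphismProperty.of_isPullback h hr

lemma fibration_of_retract {B E Y : SSet.{u}} (e : E ⟶ B) [Fibration e] (ι : Y ⟶ E) (ρ : E ⟶ Y)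
    (h₁ : ι ≫ ρ = 𝟙 Y) (h₂ : ρ ≫ ι ≫ e = e) : Fibration (ι ≫ e) := by
  have r : RetractArrow (ι ≫ e) e :=
    { i := Arrow.homMk ι (𝟙 B) (by simp)
      r := Arrow.homMk ρ (𝟙 B) (by simpa using h₂)
      retract := CommaMorphism.ext h₁ (Category.comp_id _) }
  rw [HomotopicalAlgebra.fibration_iff]
  exact MorphismProperty.of_retract r ((HomotopicalAlgebra.fibration_iff _).1 inferInstance)

/-- Embed `X` in some `V` with `V ⟶ ⊤_` a trivial fibration; the embedding extends along `i`. -/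
lemma mono_of_anodyne {X Y : SSet.{u}} {i : X ⟶ Y} (hi : anodyneExtensions i) : Mono i := by
  obtain ⟨V, l, q, hl, hq, -⟩ := exists_mono_trivFib (terminal.from X)
  have := hq.fibration
  have := hasLiftingProperty_of_anodyne hi q
  have sq : CommSq l i q (terminal.from Y) := ⟨by subsingleton⟩
  exact mono_of_mono_fac sq.fac_left

lemma exists_anodyne_fibration {X Y : SSet.{u}} (f : X ⟶ Y) :
    ∃ (V : SSet.{u}) (i : X ⟶ V) (q : V ⟶ Y), anodyneExtensions i ∧ Fibration q ∧ i ≫ q = f := by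
  let h := MorphismProperty.factorizationData (SSet.modelCategoryQuillen.J.{u}.rlp.llp)
    SSet.modelCategoryQuillen.J.{u}.rlp f
  refine ⟨h.Z, h.i, h.p, ?_, ?_, h.fac⟩
  · rw [anodyneExtensions_eq_llp_rlp]
    exact h.hi
  · rw [fibration_iff]
    exact h.hp

/-- A map from `f : A ⟶ B` pulled back to a fibration over the base. -/
def FibrationExtends {A B X : SSet.{u}} (m : A ⟶ B) (x : X ⟶ A) : Prop :=
  ∃ (Y : SSet.{u}) (e : Y ⟶ B) (t : X ⟶ Y), Fibration e ∧ IsPullback t x e m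

/-- Factoring the equivalence `w` as an anodyne `j` followed by a fibration `q` leaves two cases:
`q` is a trivial fibration, and `X` is a strong deformation retract of `V₁` over `A`. Both are
extended by `exists_retract_extension`. -/
lemma FibrationExtends.of_fibHomotopic {A B X P : SSet.{u}} {m : A ⟶ B} [Mono m] {p : P ⟶ A}
    (hp : FibrationExtends m p) (x : X ⟶ A) [Fibration x] (w : X ⟶ P) (u : P ⟶ X)
    (hw : w ≫ p = x) (hu : u ≫ x = p)
    (huw : FibHomotopic p (u ≫ w) (𝟙 P)) (hwu : FibHomotopic x (w ≫ u) (𝟙 X)) :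
    FibrationExtends m x := by
  obtain ⟨Y', e', tP, he', hP⟩ := hp
  have : Fibration p := fibration_of_isPullback hP
  have : Mono tP := MorphismProperty.of_isPullback (P := MorphismProperty.monomorphisms _)
    hP.flip (MorphismProperty.monomorphisms.infer_property m)
  obtain ⟨V₁, j, q, hj, hq, rfl⟩ := exists_anodyne_fibration w
  have : Mono j := mono_of_anodyne hj
  have hqp : j ≫ q ≫ p = x := by rw [← hw, Category.assoc]
  have hlj := hasLiftingProperty_of_anodyne hj x
  obtain ⟨r, H, hr, h₀, h₁, hH, hjH⟩ := exists_deformation_retraction j (q ≫ p)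
    (by rwa [hqp]) (hasLiftingProperty_pushoutProduct_of_anodyne hj _)
  have hrj : FibHomotopic (q ≫ p) (𝟙 V₁) (r ≫ j) := ⟨H, h₀, h₁, by rw [hH, Category.id_comp]⟩
  have hq' : TrivFib q := by
    obtain ⟨g, hg, hgg⟩ := exists_homotopy_lift_of_start q p (u ≫ j) (𝟙 P)
      (by rwa [Category.assoc])
    refine trivFib_of_homotopic q (q ≫ p) g hg ?_
    have e₁ := (hrj.postcomp q (q := p) rfl).postcomp (u ≫ j) (q := q ≫ p)
      (by rw [Category.assoc, hqp, hu])
    have e₂ := (hwu.precomp r).postcomp j (q := q ≫ p) hqp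
    have e₃ := hgg.precomp q
    simp only [Category.assoc, Category.id_comp, Category.comp_id] at e₁ e₂ e₃
    -- The chain `𝟙 ∼ r ≫ j ∼ r ≫ j ≫ q ≫ u ≫ j ∼ q ≫ u ≫ j ∼ q ≫ g`, all over `A`.
    exact hrj.trans (e₂.symm.trans (e₁.symm.trans e₃))
  -- `V₁` embeds in the restriction to `P` of a trivial fibration over `Y'`. Both are trivial
  -- fibrations over `P`, so `V₁` is a strong deformation retract there and `q` extends over `Y'`.
  obtain ⟨V₂, i, q₂, hi, hq₂, hiq⟩ := exists_mono_trivFib (q ≫ tP)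
  have := hq₂.fibration
  have hW := IsPullback.of_hasPullback q₂ tP
  let j' : V₁ ⟶ pullback q₂ tP := pullback.lift i q hiq
  have hj' : j' ≫ pullback.snd q₂ tP = q := pullback.lift_snd _ _ _
  have : Mono j' := mono_of_mono_fac (pullback.lift_fst i q hiq)
  have hs : TrivFib (pullback.snd q₂ tP) := MorphismProperty.of_isPullback hW hq₂
  have hlj' := hq'.hasLift j'
  obtain ⟨r', H', hr', h₀', h₁', hH', hjH'⟩ := exists_deformation_retraction j'
    (pullback.snd q₂ tP) (by rwa [hj']) (hs.hasLiftingProperty_pushoutProduct j')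
  obtain ⟨V, ι, ρ, t, hιρ, hρ, hV⟩ := exists_retract_extension hW j' r' H' h₀' h₁' hH' hjH'
  rw [hj'] at hV
  have := fibration_of_retract q₂ ι ρ hιρ hρ
  obtain ⟨Y, ι', ρ', t', hιρ', hρ', hY⟩ :=
    exists_retract_extension (hV.paste_vert hP) j r H h₀ h₁ hH hjH
  rw [hqp] at hY
  exact ⟨Y, _, t', fibration_of_retract _ ι' ρ' hιρ' hρ', hY⟩

/-! ### Transport along a homotopy -/

lemma exists_path_lift (e : Fin 2) {R W P : SSet.{u}} (q : W ⟶ P) [Fibration q]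
    (g : R ⟶ W) (H : R ⊗ Δ[1] ⟶ P) (h : endpt e ≫ H = g ≫ q) :
    ∃ G : R ⊗ Δ[1] ⟶ W, endpt e ≫ G = g ∧ G ≫ q = H := by
  have hl : HasLiftingProperty (R ◁ Λ[1, e].ι) q :=
    (anodyneExtensions.horn_ι.{u} (e : Fin 2)).whiskerLeft R q
      (by rwa [← HomotopicalAlgebra.fibration_iff])
  have sq : CommSq (fst _ _ ≫ g) (R ◁ Λ[1, e].ι) q H :=
    ⟨by rw [whiskerLeft_horn_one_ι, Category.assoc, Category.assoc, h]⟩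
  have hf := sq.fac_left
  refine ⟨sq.lift, ?_, sq.fac_right⟩
  let s : R ⟶ R ⊗ (Λ[1, e] : SSet.{u}) := lift (𝟙 R) (SSet.const ⟨stdSimplex.obj₀Equiv.symm e, by
    rw [mem_horn_iff_notMem_range]
    refine ⟨1 - e, one_sub_ne e, ?_⟩
    rintro ⟨i, hi⟩
    exact one_sub_ne e hi.symm⟩)
  exact congr(s ≫ $hf)

/-- Lifting the paths of `A ⊗ Δ[1]` starting in one end fibration transports it to the other end.
Uniqueness of transport up to fibrewise homotopy makes the two transports inverse. -/
lemma exists_transport {A Z X X' : SSet.{u}} (z : Z ⟶ A ⊗ Δ[1]) [Fibration z] {e e' : Fin 2}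
    {ζ : X ⟶ Z} {x : X ⟶ A} (h : IsPullback ζ x z (endpt e))
    {ζ' : X' ⟶ Z} {x' : X' ⟶ A} (h' : IsPullback ζ' x' z (endpt e')) :
    ∃ (φ : X ⟶ X') (φ' : X' ⟶ X), φ ≫ x' = x ∧ φ' ≫ x = x' ∧
      FibHomotopic x (φ ≫ φ') (𝟙 X) ∧ FibHomotopic x' (φ' ≫ φ) (𝟙 X') := by
  have key {e e' : Fin 2} {X X' : SSet.{u}} {ζ : X ⟶ Z} {x : X ⟶ A}
      (h : IsPullback ζ x z (endpt e)) {ζ' : X' ⟶ Z} {x' : X' ⟶ A}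
      (h' : IsPullback ζ' x' z (endpt e')) {φ : X ⟶ X'} {φ' : X' ⟶ X} (hφ : φ ≫ x' = x)
      (hφ' : φ' ≫ x = x') (T : X ⊗ Δ[1] ⟶ Z) (hT₁ : endpt e ≫ T = ζ) (hT₂ : T ≫ z = x ▷ _)
      (hT₃ : endpt e' ≫ T = φ ≫ ζ') (T' : X' ⊗ Δ[1] ⟶ Z) (hT₁' : endpt e' ≫ T' = ζ')
      (hT₂' : T' ≫ z = x' ▷ _) (hT₃' : endpt e ≫ T' = φ' ≫ ζ) :
      FibHomotopic x (𝟙 X) (φ ≫ φ') := by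
    -- The sides are the path `T` and the return path `T'` after `φ`, which meet at the end `e'`.
    -- The face at `e` joins `𝟙 X` to `φ ≫ φ'` inside the fibration over that end.
    obtain ⟨G, hG₁, hG₂, hG₃, hG₄⟩ := exists_box_lift e' z (fst X Δ[1] ▷ Δ[1] ≫ x ▷ Δ[1])
      (fst _ _ ≫ φ ≫ ζ') T (φ ▷ _ ≫ T')
      (by rw [Category.assoc, Category.assoc, h'.w, reassoc_of% hφ, endpt_comp_assoc, endpt_comp])
      (by rw [← comp_whiskerRight_assoc, endpt_fst, id_whiskerRight, Category.id_comp, hT₂])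
      (by rw [← comp_whiskerRight_assoc, endpt_fst, id_whiskerRight, Category.id_comp,
        Category.assoc, hT₂', ← comp_whiskerRight, hφ])
      (by rw [hT₃, endpt_fst_assoc])
      (by rw [endpt_comp_assoc, hT₁', endpt_fst_assoc])
    have hw : (endpt e ≫ G) ≫ z = (fst _ _ ≫ x) ≫ endpt e := by
      rw [Category.assoc, hG₄, endpt_comp_assoc, endpt_comp, Category.assoc]
    refine ⟨h.lift (endpt e ≫ G) (fst _ _ ≫ x) hw, ?_, ?_, ?_⟩
    · apply h.hom_ext
      · rw [Category.assoc, h.lift_fst, ← endpt_comp_assoc, hG₂, hT₁, Category.id_comp]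
      · rw [Category.assoc, h.lift_snd, endpt_fst_assoc, Category.id_comp]
    · apply h.hom_ext
      · rw [Category.assoc, h.lift_fst, ← endpt_comp_assoc, hG₃, endpt_comp_assoc, hT₃',
          Category.assoc]
      · rw [Category.assoc, h.lift_snd, endpt_fst_assoc, Category.assoc, hφ', hφ]
    · rw [h.lift_snd, Category.id_comp]
  have hx : Fibration x := fibration_of_isPullback h
  have hx' : Fibration x' := fibration_of_isPullback h'
  obtain ⟨T, hT₁, hT₂⟩ := exists_path_lift e z ζ (x ▷ Δ[1]) (by rw [endpt_comp, h.w])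
  obtain ⟨T', hT₁', hT₂'⟩ := exists_path_lift e' z ζ' (x' ▷ Δ[1]) (by rw [endpt_comp, h'.w])
  let φ : X ⟶ X' := h'.lift (endpt e' ≫ T) x (by rw [Category.assoc, hT₂, endpt_comp])
  let φ' : X' ⟶ X := h.lift (endpt e ≫ T') x' (by rw [Category.assoc, hT₂', endpt_comp])
  have hφ : φ ≫ x' = x := h'.lift_snd _ _ _
  have hφ' : φ' ≫ x = x' := h.lift_snd _ _ _
  have hT₃ : endpt e' ≫ T = φ ≫ ζ' := (h'.lift_fst _ _ _).symm
  have hT₃' : endpt e ≫ T' = φ' ≫ ζ := (h.lift_fst _ _ _).symm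
  exact ⟨φ, φ', hφ, hφ', (key h h' hφ hφ' T hT₁ hT₂ hT₃ T' hT₁' hT₂' hT₃').symm,
    (key h' h hφ' hφ T' hT₁' hT₂' hT₃' T hT₁ hT₂ hT₃).symm⟩

/-- If the pullback of a fibration along one end of a homotopy extends, then so does the pullback
along the other end. -/
lemma FibrationExtends.of_homotopy {A B D E X P : SSet.{u}} {m : A ⟶ B} [Mono m] {p : P ⟶ A}
    (hp : FibrationExtends m p) (d : E ⟶ D) [Fibration d] (H : A ⊗ Δ[1] ⟶ D) (e e' : Fin 2)
    {tP : P ⟶ E} (hP : IsPullback tP p d (endpt e ≫ H)) {tX : X ⟶ E} {x : X ⟶ A}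
    (hX : IsPullback tX x d (endpt e' ≫ H)) : FibrationExtends m x := by
  have : Fibration x := fibration_of_isPullback hX
  have hZ := IsPullback.of_hasPullback d H
  have : Fibration (pullback.snd d H) := fibration_of_isPullback hZ
  obtain ⟨φ, φ', h₁, h₂, h₃, h₄⟩ := exists_transport (pullback.snd d H)
    (IsPullback.of_bot' hX.flip hZ.flip).flip (IsPullback.of_bot' hP.flip hZ.flip).flip
  exact hp.of_fibHomotopic x φ φ' h₁ h₂ h₄ h₃

/-! ### Extension of fibrations along horn inclusions -/

/-- The map `Δ[n] ⊗ Δ[1] ⟶ Δ[n]` given by a monotone map. -/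
def simplexHomotopy {n : ℕ} (g : Fin (n + 1) × Fin 2 →o Fin (n + 1)) :
    (Δ[n] : SSet.{u}) ⊗ Δ[1] ⟶ Δ[n] where
  app m := ↾fun x => stdSimplex.objEquiv.symm (SimplexCategory.Hom.mk
    (g.comp ((stdSimplex.objEquiv x.1).toOrderHom.prod (stdSimplex.objEquiv x.2).toOrderHom)))
  naturality m m' f := by
    ext x
    rfl

/-- The restriction of `simplexHomotopy g` to a horn. -/
def hornHomotopy {n : ℕ} (k : Fin (n + 1)) (g : Fin (n + 1) × Fin 2 →o Fin (n + 1))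
    (hg : ∀ a b, g (a, b) = a ∨ g (a, b) = k) : (Λ[n, k] : SSet.{u}) ⊗ Δ[1] ⟶ (Λ[n, k] : SSet.{u}) :=
  Subcomplex.lift (Λ[n, k].ι ▷ _ ≫ simplexHomotopy g) (by
    rintro ⟨m⟩ _ ⟨⟨⟨x, hx⟩, t⟩, rfl⟩
    induction m using SimplexCategory.rec with | _ m
    rw [mem_horn_iff_notMem_range] at hx ⊢
    obtain ⟨j, hj, hx⟩ := hx
    refine ⟨j, hj, ?_⟩
    rintro ⟨i, hi⟩
    obtain h | h := hg (x i) (t i)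
    · exact hx ⟨i, h.symm.trans hi⟩
    · exact hj (hi.symm.trans h))

lemma horn_hom_ext {n : ℕ} {k : Fin (n + 1)} {X : SSet.{u}} {f g : X ⟶ (Λ[n, k] : SSet.{u})}
    (h : ∀ (m : ℕ) (x : X _⦋m⦌) i, (f.app _ x).1 i = (g.app _ x).1 i) : f = g := by
  ext ⟨m⟩ x
  induction m using SimplexCategory.rec with | _ m
  exact Subtype.ext (SSet.stdSimplex.ext _ _ (h m x))

/-- The constant map to the `k`-th vertex of `Λ[n, k]`. -/
def hornVertex (X : SSet.{u}) {n : ℕ} [NeZero n] (k : Fin (n + 1)) : X ⟶ (Λ[n, k] : SSet.{u}) :=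
  SSet.const ⟨stdSimplex.obj₀Equiv.symm k, by
    rw [mem_horn_iff_notMem_range]
    obtain ⟨j, hj⟩ := exists_ne k
    refine ⟨j, hj, ?_⟩
    rintro ⟨i, hi⟩
    exact hj hi.symm⟩

lemma FibrationExtends.of_exists {A B X E : SSet.{u}} {m : A ⟶ B} {x : X ⟶ A} {d : E ⟶ A} [Fibration d]
    {t : X ⟶ E} (g : B ⟶ A) (h : IsPullback t x d (m ≫ g)) : FibrationExtends m x :=
  ⟨_, pullback.snd d g, _, fibration_of_isPullback (IsPullback.of_hasPullback d g),
    (IsPullback.of_bot' h.flip (IsPullback.of_hasPullback d g).flip).flip⟩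

/-- Kan fibrations extend along horn inclusions. -/
lemma fibrationExtends_horn {n : ℕ} [NeZero n] (k : Fin (n + 1)) {X : SSet.{u}}
    (x : X ⟶ (Λ[n, k] : SSet.{u})) [Fibration x] : FibrationExtends Λ[n, k].ι x := by
  -- The zigzag `a ≤ max a k ≥ k` contracts the horn to its vertex `k`. Every value is `a` or `k`,
  -- so the homotopies stay in the horn.
  let g₁ : Fin (n + 1) × Fin 2 →o Fin (n + 1) :=
    ⟨fun p => if p.2 = 0 then p.1 else max p.1 k, by
      rintro ⟨a, b⟩ ⟨a', b'⟩ ⟨h₁, h₂⟩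
      dsimp at h₁ h₂ ⊢
      split_ifs with hb hb'
      · exact h₁
      · exact h₁.trans (le_max_left _ _)
      · omega
      · exact max_le_max_right k h₁⟩
  let g₂ : Fin (n + 1) × Fin 2 →o Fin (n + 1) :=
    ⟨fun p => if p.2 = 0 then k else max p.1 k, by
      rintro ⟨a, b⟩ ⟨a', b'⟩ ⟨h₁, h₂⟩
      dsimp at h₁ h₂ ⊢
      split_ifs with hb hb'
      · exact le_rfl
      · exact le_max_right _ _
      · omega
      · exact max_le_max_right k h₁⟩
  have hg₁ a b : g₁ (a, b) = a ∨ g₁ (a, b) = k := by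
    change (if b = 0 then a else max a k) = a ∨ (if b = 0 then a else max a k) = k
    split_ifs
    · exact .inl rfl
    · exact max_choice a k
  have hg₂ a b : g₂ (a, b) = a ∨ g₂ (a, b) = k := by
    change (if b = 0 then k else max a k) = a ∨ (if b = 0 then k else max a k) = k
    split_ifs
    · exact .inr rfl
    · exact max_choice a k
  have h₁ : endpt 0 ≫ hornHomotopy k g₁ hg₁ = 𝟙 _ := horn_hom_ext fun m y i => rfl
  have h₂ : endpt 0 ≫ hornHomotopy k g₂ hg₂ = hornVertex _ k := horn_hom_ext fun m y i => rfl
  have h₃ : endpt 1 ≫ hornHomotopy k g₁ hg₁ = endpt 1 ≫ hornHomotopy k g₂ hg₂ :=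
    horn_hom_ext fun m y i => rfl
  -- The constant map extends over the simplex, so the pullback along it does too; two homotopies
  -- carry the extension back to `x`.
  have h₀ : FibrationExtends Λ[n, k].ι (pullback.snd x (hornVertex (Λ[n, k] : SSet.{u}) k)) :=
    .of_exists (hornVertex Δ[n] k) (IsPullback.of_hasPullback x (hornVertex _ k))
  have h₅ : FibrationExtends Λ[n, k].ι (pullback.snd x (endpt 1 ≫ hornHomotopy k g₂ hg₂)) :=
    h₀.of_homotopy x (hornHomotopy k g₂ hg₂) 0 1
      (by rw [h₂]; exact IsPullback.of_hasPullback _ _) (IsPullback.of_hasPullback _ _)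
  refine h₅.of_homotopy x (hornHomotopy k g₁ hg₁) 1 0
    (by rw [h₃]; exact IsPullback.of_hasPullback _ _) (tX := 𝟙 X) ?_
  rw [h₁]
  exact IsPullback.of_id_fst

/-! ### Sub-objects of bounded size -/

lemma nonempty_embedding_sigma {I : Type*} [Countable I] (A : I → Type*) (S : Type u) [Infinite S]
    (h : ∀ i, Nonempty (A i ↪ S)) : Nonempty ((Σ i, A i) ↪ S) := by
  obtain ⟨f, hf⟩ := exists_injective_nat I
  obtain ⟨g⟩ : Nonempty (ℕ × S ↪ S) := by
    rw [← Cardinal.lift_mk_le', Cardinal.mk_prod, Cardinal.lift_mul, Cardinal.lift_lift]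
    simp
  refine ⟨⟨fun x => g (f x.1, (h x.1).some x.2), ?_⟩⟩
  rintro ⟨i, x⟩ ⟨j, y⟩ hxy
  have := g.injective hxy
  rw [Prod.mk.injEq] at this
  obtain rfl := hf this.1
  obtain rfl := (h i).some.injective this.2
  rfl

lemma nonempty_embedding_sum {A B : Type*} (S : Type u) [Infinite S]
    (hA : Nonempty (A ↪ S)) (hB : Nonempty (B ↪ S)) : Nonempty ((A ⊕ B) ↪ S) := by
  obtain ⟨g⟩ := nonempty_embedding_sigma (fun _ : Bool => S) S fun _ => ⟨.refl S⟩
  refine ⟨⟨fun x => g (x.elim (fun a => ⟨true, hA.some a⟩) (fun b => ⟨false, hB.some b⟩)), ?_⟩⟩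
  rintro (a | a) (b | b) h <;> simpa using g.injective h

lemma nonempty_embedding_of_countable (A : Type*) [Countable A] (S : Type u) [Infinite S] :
    Nonempty (A ↪ S) := by
  obtain ⟨f, hf⟩ := exists_injective_nat A
  exact ⟨(⟨f, hf⟩ : A ↪ ℕ).trans (Infinite.natEmbedding S)⟩

/-- A bound on the size of a set generated by finitary partial operations. -/
lemma exists_closed_set {T O : Type u} (ar : O → ℕ) (op : ∀ o, (Fin (ar o) → T) → Option T)
    (S : Type u) [Infinite S] (hO : Nonempty (O ↪ S)) :
    ∃ R : Set T, (∀ o g, (∀ i, g i ∈ R) → ∀ t, op o g = some t → t ∈ R) ∧ Nonempty (R ↪ S) := by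
  classical
  -- The closed set consists of the values of formal terms; finitary terms on `O` number at most
  -- `max (#O) ℵ₀`.
  let ev : WType (fun o => Fin (ar o)) → Option T := WType.elim (Option T) fun x =>
    if h : ∃ g' : Fin (ar x.1) → T, ∀ i, x.2 i = some (g' i) then op x.1 h.choose else none
  refine ⟨Set.ofPred fun t => ∃ w, ev w = some t, fun o g hg t ht => ?_, ?_⟩
  · choose w hw using hg
    refine ⟨.mk o w, ?_⟩
    have h : ∃ g' : Fin (ar o) → T, ∀ i, ev (w i) = some (g' i) := ⟨g, hw⟩
    have h' : h.choose = g := funext fun i => Option.some.inj ((h.choose_spec i).symm.trans (hw i))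
    change (if h : ∃ g' : Fin (ar o) → T, ∀ i, ev (w i) = some (g' i) then op o h.choose else none)
      = _
    rw [dif_pos h, h', ht]
  · have h₁ : Nonempty (WType (fun o => Fin (ar o)) ↪ S) := by
      have := WType.cardinalMk_le_max_aleph0_of_finite' (α := O) (β := fun o => Fin (ar o))
      rw [← Cardinal.lift_mk_le', Cardinal.lift_id, Cardinal.lift_id]
      refine this.trans (max_le ?_ (Cardinal.aleph0_le_mk S))
      rw [Cardinal.lift_uzero]
      exact Cardinal.mk_le_of_injective hO.some.injective
    obtain ⟨f⟩ := h₁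
    refine ⟨⟨fun t => f t.2.choose, fun t t' h => Subtype.ext ?_⟩⟩
    have := f.injective h
    exact Option.some.inj (t.2.choose_spec.symm.trans ((congr_arg ev this).trans t'.2.choose_spec))

instance : Countable SimplexCategory :=
  Function.Injective.countable (f := SimplexCategory.len) fun _ _ h => SimplexCategory.ext h

instance : Countable SimplexCategoryᵒᵖ := (equivToOpposite (α := SimplexCategory)).symm.injective.countable

instance (a b : SimplexCategory) : Finite (a ⟶ b) :=
  Finite.of_injective (fun f => (f.toOrderHom : Fin (a.len + 1) → Fin (b.len + 1)))
    fun _ _ h => SimplexCategory.Hom.ext _ _ (OrderHom.ext _ _ h)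

instance (a b : SimplexCategoryᵒᵖ) : Finite (a ⟶ b) :=
  Finite.of_injective (fun f => f.unop) fun _ _ h => Quiver.Hom.unop_inj h

/-- A simplicial set is of size at most `S`. -/
def SizeLE (X : SSet.{u}) (S : Type u) : Prop := ∀ m, Nonempty (X.obj m ↪ S)

lemma fibration_of_horn_fillers {E B : SSet.{u}} (p : E ⟶ B)
    (h : ∀ (n : ℕ) (k : Fin (n + 2)) (α : (Λ[n + 1, k] : SSet.{u}) ⟶ E) (β : Δ[n + 1] ⟶ B),
      α ≫ p = Λ[n + 1, k].ι ≫ β → ∃ l : Δ[n + 1] ⟶ E, Λ[n + 1, k].ι ≫ l = α ∧ l ≫ p = β) :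
    Fibration p := by
  rw [fibration_iff]
  intro _ _ i hi
  simp only [J, MorphismProperty.iSup_iff] at hi
  obtain ⟨n, ⟨k⟩⟩ := hi
  refine ⟨fun {α β} sq => ?_⟩
  obtain ⟨l, hl₁, hl₂⟩ := h n k α β sq.w
  exact ⟨⟨⟨l, hl₁, hl₂⟩⟩⟩

lemma exists_horn_filler {E B : SSet.{u}} (p : E ⟶ B) [Fibration p] {n : ℕ} [NeZero n]
    {k : Fin (n + 1)} (α : (Λ[n, k] : SSet.{u}) ⟶ E) (β : Δ[n] ⟶ B)
    (h : α ≫ p = Λ[n, k].ι ≫ β) : ∃ l : Δ[n] ⟶ E, Λ[n, k].ι ≫ l = α ∧ l ≫ p = β := by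
  have := hasLiftingProperty_of_anodyne (anodyneExtensions.horn_ι k) p
  have sq : CommSq α Λ[n, k].ι p β := ⟨h⟩
  exact ⟨sq.lift, sq.fac_left, sq.fac_right⟩

lemma horn_face_app {n : ℕ} {k j : Fin (n + 2)} (h : j ≠ k) {Y : SSet.{u}} (y : Y _⦋n + 1⦌) :
    (Λ[n + 1, k].ι ≫ SSet.yonedaEquiv.symm y).app _ (horn.face k j h) = Y.δ j y := by
  change (SSet.yonedaEquiv.symm y).app _ (SSet.yonedaEquiv (stdSimplex.δ j)) = _
  rw [← SSet.yonedaEquiv_comp]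
  rfl

/-- A sub-fibration of bounded size. -/
lemma exists_small_subfibration {X Y D : SSet.{u}} (e : Y ⟶ D) [Fibration e] (t : X ⟶ Y)
    (S : Type u) [Infinite S] (hX : SizeLE X S) (hD : SizeLE D S) :
    ∃ Z : Y.Subcomplex, Subcomplex.range t ≤ Z ∧ Fibration (Z.ι ≫ e) ∧ SizeLE Z S := by
  classical
  -- Three kinds of operations: constants from `X`, simplicial operators, and a chosen horn filler
  -- for each simplex of `D` in positive dimension and each omitted face.
  let O := (Σ m, X.obj m) ⊕ (ULift.{u} (Σ m m' : SimplexCategoryᵒᵖ, m ⟶ m')) ⊕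
    (Σ (n : ℕ) (_ : Fin (n + 2)), D.obj (op ⦋n + 1⦌))
  have hO : Nonempty (O ↪ S) :=
    nonempty_embedding_sum S (nonempty_embedding_sigma _ S hX) (nonempty_embedding_sum S
      (nonempty_embedding_of_countable _ S) (nonempty_embedding_sigma _ S fun n =>
        nonempty_embedding_sigma _ S fun k => hD _))
  let ar : O → ℕ := fun o => match o with
    | .inl _ => 0
    | .inr (.inl _) => 1
    | .inr (.inr ⟨n, _⟩) => n + 2
  let opr : ∀ o, (Fin (ar o) → (Σ m, Y.obj m)) → Option (Σ m, Y.obj m) := fun o => match o with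
    | .inl ⟨m, x⟩ => fun _ => some ⟨m, t.app m x⟩
    | .inr (.inl ⟨m, m', f⟩) => fun g =>
      if h : ∃ y : Y.obj m, g (0 : Fin 1) = ⟨m, y⟩ then some ⟨m', Y.map f h.choose⟩ else none
    | .inr (.inr ⟨n, k, d⟩) => fun g =>
      if h : ∃ y : Y _⦋n + 1⦌, e.app _ y = d ∧ ∀ (j : Fin (n + 2)), j ≠ k → g j = ⟨op ⦋n⦌, Y.δ j y⟩
      then some ⟨op ⦋n + 1⦌, h.choose⟩ else none
  obtain ⟨R, hR, ⟨φ⟩⟩ := exists_closed_set ar opr S hO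
  have hbase (m) (x : X.obj m) : ⟨m, t.app m x⟩ ∈ R :=
    hR (.inl ⟨m, x⟩) Fin.elim0 (fun i => i.elim0) _ rfl
  have hmap {m m'} (f : m ⟶ m') (y : Y.obj m) (hy : ⟨m, y⟩ ∈ R) : ⟨m', Y.map f y⟩ ∈ R := by
    refine hR (.inr (.inl ⟨m, m', f⟩)) (fun _ => ⟨m, y⟩) (fun _ => hy) _ ?_
    have h : ∃ y' : Y.obj m, (⟨m, y⟩ : Σ m, Y.obj m) = ⟨m, y'⟩ := ⟨y, rfl⟩
    have h' : h.choose = y := (eq_of_heq (Sigma.mk.inj h.choose_spec).2).symm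
    change (if h : ∃ y' : Y.obj m, (⟨m, y⟩ : Σ m, Y.obj m) = ⟨m, y'⟩
      then some (⟨m', Y.map f h.choose⟩ : Σ m, Y.obj m) else none) = _
    rw [dif_pos h, h']
  have hfill {n} {k : Fin (n + 2)} (y : Y _⦋n + 1⦌)
      (hy : ∀ j, j ≠ k → (⟨op ⦋n⦌, Y.δ j y⟩ : Σ m, Y.obj m) ∈ R) :
      ∃ y' : Y _⦋n + 1⦌, ⟨_, y'⟩ ∈ R ∧ e.app _ y' = e.app _ y ∧ ∀ j, j ≠ k → Y.δ j y' = Y.δ j y := by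
    -- The `k`-th argument of a filling operation is ignored; another face is put there so that all
    -- arguments lie in `R`.
    obtain ⟨j₀, hj₀⟩ := exists_ne k
    have h : ∃ y' : Y _⦋n + 1⦌, e.app _ y' = e.app _ y ∧ ∀ (j : Fin (n + 2)), j ≠ k →
        (⟨op ⦋n⦌, Y.δ (if j = k then j₀ else j) y⟩ : Σ m, Y.obj m) = ⟨op ⦋n⦌, Y.δ j y'⟩ :=
      ⟨y, rfl, fun j hj => by rw [if_neg hj]⟩
    refine ⟨h.choose, ?_, h.choose_spec.1, fun j hj => ?_⟩
    · refine hR (.inr (.inr ⟨n, k, e.app _ y⟩))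
        (fun (j : Fin (n + 2)) => ⟨op ⦋n⦌, Y.δ (if j = k then j₀ else j) y⟩)
        (fun (j : Fin (n + 2)) => ?_) _ (dif_pos h)
      split_ifs with hj
      · exact hy j₀ hj₀
      · exact hy j hj
    · have := h.choose_spec.2 j hj
      rw [if_neg hj] at this
      simpa using this.symm
  let Z : Y.Subcomplex :=
    { obj m := Set.ofPred fun y : Y.obj m => (⟨m, y⟩ : Σ m, Y.obj m) ∈ R
      map f y hy := hmap f _ hy }
  refine ⟨Z, ?_, ?_, fun m => ⟨⟨fun y => φ ⟨⟨m, y.1⟩, y.2⟩, fun _ _ h => Subtype.ext ?_⟩⟩⟩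
  · rintro m _ ⟨x, rfl⟩
    exact hbase m x
  · refine fibration_of_horn_fillers _ fun n k α β h => ?_
    obtain ⟨l, hl₁, hl₂⟩ := exists_horn_filler e (α ≫ Z.ι) β (by rw [Category.assoc, h])
    have hl (j) (hj : j ≠ k) : Y.δ j (SSet.yonedaEquiv l) = (α.app _ (horn.face k j hj)).1 := by
      rw [← horn_face_app hj, Equiv.symm_apply_apply, hl₁]; rfl
    obtain ⟨y, hyR, hy₁, hy₂⟩ := hfill (k := k) (SSet.yonedaEquiv l) (fun j hj => by
      rw [hl j hj]
      exact (α.app _ (horn.face k j hj)).2)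
    have hyl : SSet.yonedaEquiv.symm (⟨y, hyR⟩ : (Z : SSet.{u}) _⦋n + 1⦌) ≫ Z.ι = SSet.yonedaEquiv.symm y := by
        exact SSet.yonedaEquiv_symm_comp (X := Z) _ Z.ι
    refine ⟨yonedaEquiv.symm (⟨y, hyR⟩ : (Z : SSet.{u}) _⦋n + 1⦌), ?_, ?_⟩
    · rw [← cancel_mono Z.ι, Category.assoc, hyl]
      refine horn.hom_ext _ _ fun j hj => ?_
      rw [horn_face_app hj, hy₂ j hj, hl j hj]; rfl
    · rw [reassoc_of% hyl, SSet.yonedaEquiv_symm_comp, hy₁, ← SSet.yonedaEquiv_comp, hl₂,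
        Equiv.symm_apply_apply]
  · have := φ.injective h
    simpa using this

/-! ### A universe of Kan fibrations -/

lemma isPullback_of_exists_of_injective {P X Y Z : SSet.{u}} {t : P ⟶ X} {l : P ⟶ Y} {r : X ⟶ Z}
    {b : Y ⟶ Z} (w : t ≫ r = l ≫ b)
    (h : ∀ n (x : X.obj n) (y : Y.obj n), r.app n x = b.app n y →
      ∃ p, t.app n p = x ∧ l.app n p = y)
    (h' : ∀ n (p p' : P.obj n), t.app n p = t.app n p' → l.app n p = l.app n p' → p = p') :
    IsPullback t l r b := by
  let φ : P ⟶ pullback r b := pullback.lift t l w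
  have hφ₁ : φ ≫ pullback.fst r b = t := pullback.lift_fst _ _ _
  have hφ₂ : φ ≫ pullback.snd r b = l := pullback.lift_snd _ _ _
  have e₁ {n} (p : P.obj n) : (pullback.fst r b).app n (φ.app n p) = t.app n p :=
    congr(($hφ₁).app n p)
  have e₂ {n} (p : P.obj n) : (pullback.snd r b).app n (φ.app n p) = l.app n p :=
    congr(($hφ₂).app n p)
  have (n : SimplexCategoryᵒᵖ) : IsIso (φ.app n) := by
    rw [isIso_iff_bijective]
    refine ⟨fun p p' hp => h' n p p' ?_ ?_, fun z => ?_⟩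
    · rw [← e₁, ← e₁]; exact congr_arg _ hp
    · rw [← e₂, ← e₂]; exact congr_arg _ hp
    · obtain ⟨p, hp, hp'⟩ := h n ((pullback.fst r b).app n z) ((pullback.snd r b).app n z)
        congr(($(pullback.condition (f := r) (g := b))).app n z)
      refine ⟨p, Types.ext_of_isPullback
        ((IsPullback.of_hasPullback r b).map ((evaluation _ (Type u)).obj n)) ?_ ?_⟩
      · exact (e₁ p).trans hp
      · exact (e₂ p).trans hp'
  have : IsIso φ := NatIso.isIso_of_isIso_app _
  exact IsPullback.of_iso_pullback ⟨w⟩ (asIso φ) hφ₁ hφ₂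

/-- Subcomplexes of `B ⊗ cofree S` that are fibrations over `B` with fibres of size at most `S`. -/
def IsSmallFibration {S : Type u} {B : SSet.{u}} (R : (B ⊗ cofree S).Subcomplex) : Prop :=
  Fibration (R.ι ≫ fst B (cofree S)) ∧
    ∀ m (x : B.obj m), Nonempty ({t : (cofree S).obj m // (x, t) ∈ R.obj m} ↪ S)

/-- Representing fibrations as subcomplexes of `B ⊗ cofree S` makes base change a preimage, hence
strictly functorial; this is what makes the universe a simplicial set. -/
lemma isPullback_preimage {A B T : SSet.{u}} (f : A ⟶ B) (R : (B ⊗ T).Subcomplex) :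
    IsPullback (R.fromPreimage (f ▷ T)) ((R.preimage (f ▷ T)).ι ≫ fst A T) (R.ι ≫ fst B T) f := by
  refine isPullback_of_exists_of_injective rfl ?_ ?_
  · rintro n ⟨⟨_, t⟩, h⟩ a rfl
    exact ⟨⟨(a, t), h⟩, rfl, rfl⟩
  · rintro n ⟨⟨a, t⟩, h⟩ ⟨⟨a', t'⟩, h'⟩ h₁ h₂
    obtain rfl : a = a' := h₂
    obtain rfl : t = t' := congr(($h₁).1.2)
    rfl

lemma IsSmallFibration.preimage {S : Type u} {A B : SSet.{u}} {R : (B ⊗ cofree S).Subcomplex}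
    (hR : IsSmallFibration R) (f : A ⟶ B) : IsSmallFibration (R.preimage (f ▷ _)) :=
  have := hR.1
  ⟨fibration_of_isPullback (isPullback_preimage f R), fun m x => hR.2 m (f.app m x)⟩

/-- The universe of Kan fibrations with fibres of size at most `S`. -/
def universalBase (S : Type u) : SSet.{u} where
  obj n := {R : (SSet.stdSimplex.obj n.unop ⊗ cofree S).Subcomplex // IsSmallFibration R}
  map f := ↾fun R => ⟨R.1.preimage (SSet.stdSimplex.map f.unop ▷ _), R.2.preimage _⟩
  map_id n := by
    refine ConcreteCategory.hom_ext _ _ fun R => Subtype.ext ?_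
    change R.1.preimage (SSet.stdSimplex.map (𝟙 n.unop) ▷ _) = R.1
    have h : SSet.stdSimplex.{u}.map (𝟙 n.unop) = 𝟙 _ := CategoryTheory.Functor.map_id _ _
    rw [h, id_whiskerRight]
    rfl
  map_comp f g := by
    refine ConcreteCategory.hom_ext _ _ fun R => Subtype.ext ?_
    change R.1.preimage (SSet.stdSimplex.map (g.unop ≫ f.unop) ▷ _) =
      (R.1.preimage (SSet.stdSimplex.map f.unop ▷ _)).preimage (SSet.stdSimplex.map g.unop ▷ _)
    have h : SSet.stdSimplex.{u}.map (g.unop ≫ f.unop) =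
      SSet.stdSimplex.map g.unop ≫ SSet.stdSimplex.map f.unop := Functor.map_comp _ _ _
    rw [h, comp_whiskerRight]
    rfl

/-- The map to the universe classifying a small fibration. -/
def classify {S : Type u} {B : SSet.{u}} {R : (B ⊗ cofree S).Subcomplex}
    (hR : IsSmallFibration R) : B ⟶ universalBase S where
  app n := ↾fun b => ⟨R.preimage (SSet.yonedaEquiv.symm b ▷ _), hR.preimage _⟩
  naturality n n' f := by
    ext b
    refine Subtype.ext ?_
    change R.preimage (SSet.yonedaEquiv.symm (B.map f b) ▷ _) =
      (R.preimage (SSet.yonedaEquiv.symm b ▷ _)).preimage (SSet.stdSimplex.map f.unop ▷ _)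
    rw [← Subcomplex.preimage_comp, ← comp_whiskerRight, SSet.yonedaEquiv_symm_naturality_left]
    rfl

/-- The small fibration classified by a map to the universe. -/
def classified {S : Type u} {B : SSet.{u}} (χ : B ⟶ universalBase S) :
    (B ⊗ cofree S).Subcomplex where
  obj n := Set.ofPred fun z => (stdSimplex.objEquiv.symm (𝟙 n.unop), z.2) ∈ (χ.app n z.1).1.obj n
  map {n n'} f z hz := by
    have h := (χ.app n z.1).1.map f hz
    have hχ := congr(($(χ.naturality f)) z.1)
    change (χ.app n' (B.map f z.1)).1.obj n' _
    have hχ' : χ.app n' (B.map f z.1) = (universalBase S).map f (χ.app n z.1) := hχ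
    rw [hχ']
    exact h

lemma preimage_classified {S : Type u} {B : SSet.{u}} (χ : B ⟶ universalBase S) {n} (b : B.obj n) :
    (classified χ).preimage (SSet.yonedaEquiv.symm b ▷ _) = (χ.app n b).1 := by
  ext m ⟨x, t⟩
  obtain ⟨f, rfl⟩ := stdSimplex.objEquiv.symm.surjective x
  have hχ : χ.app m (B.map f.op b) = (universalBase S).map f.op (χ.app n b) :=
    congr(($(χ.naturality f.op)) b)
  change (stdSimplex.objEquiv.symm (𝟙 m.unop), t) ∈ (χ.app m (B.map f.op b)).1.obj m ↔ _
  rw [hχ]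
  change ((stdSimplex.objEquiv.symm (𝟙 m.unop ≫ f) : (SSet.stdSimplex.obj n.unop).obj m), t) ∈
    (χ.app n b).1.obj m ↔ _
  rw [Category.id_comp]
  rfl

lemma classified_classify {S : Type u} {B : SSet.{u}} {R : (B ⊗ cofree S).Subcomplex}
    (hR : IsSmallFibration R) : classified (classify hR) = R := by
  ext m ⟨b, t⟩
  change ((B.map (𝟙 m) b, t) : (B ⊗ cofree S).obj m) ∈ R.obj m ↔ _
  rw [B.map_id]
  rfl

lemma preimage_classified_comp {S : Type u} {A B : SSet.{u}} (f : A ⟶ B) (χ : B ⟶ universalBase S) :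
    (classified χ).preimage (f ▷ _) = classified (f ≫ χ) := rfl

lemma hom_ext_of_classified_eq {S : Type u} {B : SSet.{u}} {χ χ' : B ⟶ universalBase S}
    (h : classified χ = classified χ') : χ = χ' := by
  ext n b
  refine Subtype.ext ?_
  have e : (χ.app n b).1 = (χ'.app n b).1 := by
    rw [← preimage_classified, ← preimage_classified, h]
  exact e

/-- A horn-filling problem involves a single simplex `b` of the base, so it can be solved after
pulling back along `b`, where the fibration is `χ b`. -/
lemma isSmallFibration_classified {S : Type u} {B : SSet.{u}} (χ : B ⟶ universalBase S) :
    IsSmallFibration (classified χ) := by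
  have key {n} (b : B.obj n) :
      IsSmallFibration ((classified χ).preimage (SSet.yonedaEquiv.symm b ▷ _)) := by
    rw [preimage_classified]
    exact (χ.app n b).2
  refine ⟨fibration_of_horn_fillers _ fun n k α β h => ?_, fun m x => ?_⟩
  · obtain ⟨b, rfl⟩ := SSet.yonedaEquiv.symm.surjective β
    have hP := isPullback_preimage (SSet.yonedaEquiv.symm b) (classified χ)
    have := (key b).1
    obtain ⟨l, hl₁, hl₂⟩ := exists_horn_filler _ (hP.lift α Λ[n + 1, k].ι h) (𝟙 _)
      (by rw [hP.lift_snd, Category.comp_id])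
    refine ⟨l ≫ (classified χ).fromPreimage _, ?_, ?_⟩
    · rw [reassoc_of% hl₁, hP.lift_fst]
    · rw [Category.assoc, hP.w]
      rw [← Category.assoc, hl₂]
      exact Category.id_comp _
  · exact (χ.app m x).2.2 m _

lemma exists_labelling {X : SSet.{u}} {S : Type u} (hX : SizeLE X S) :
    ∃ d : ∀ m, X.obj m → S, ∀ m, Function.Injective (d m) :=
  ⟨fun m => (hX m).some, fun m => (hX m).some.injective⟩

lemma sizeLE_of_isSmallFibration {S : Type u} [Infinite S] {B : SSet.{u}}
    {R : (B ⊗ cofree S).Subcomplex} (hR : IsSmallFibration R) (hB : ∀ m, Countable (B.obj m)) :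
    SizeLE R S := fun m => by
  have := hB m
  obtain ⟨f⟩ := nonempty_embedding_sigma _ S (hR.2 m)
  refine ⟨⟨fun z => f ⟨z.1.1, z.1.2, z.2⟩, ?_⟩⟩
  rintro ⟨⟨b, t⟩, h⟩ ⟨⟨b', t'⟩, h'⟩ hf
  have := Sigma.mk.inj (f.injective hf)
  obtain rfl := this.1
  obtain rfl := congr_arg Subtype.val (eq_of_heq this.2)
  rfl

lemma isSmallFibration_range {S : Type u} {B E : SSet.{u}} (p : E ⟶ B) [Fibration p]
    (c : E ⟶ cofree S) [Mono (lift p c)] (hE : SizeLE E S) :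
    IsSmallFibration (Subcomplex.range (lift p c)) := by
  refine ⟨?_, fun m b => ?_⟩
  · have h : Subcomplex.toRange (lift p c) ≫ (Subcomplex.range (lift p c)).ι ≫ fst _ _ = p := rfl
    rw [← IsIso.eq_inv_comp] at h
    rw [h]
    infer_instance
  · refine ⟨⟨fun t => (hE m).some t.2.choose, fun t t' h => Subtype.ext ?_⟩⟩
    have h₁ := (hE m).some.injective h
    have h₂ := t.2.choose_spec
    rw [h₁] at h₂
    exact congr_arg Prod.snd (h₂.symm.trans t'.2.choose_spec)

instance (n : SimplexCategory) (m : SimplexCategoryᵒᵖ) :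
    Countable ((SSet.stdSimplex.{u}.obj n).obj m) :=
  stdSimplex.objEquiv.injective.countable

/-- The universe is a Kan complex. -/
lemma kanComplex_universalBase (S : Type u) [Infinite S] : SSet.KanComplex (universalBase S) := by
  refine (isFibrant_iff _).2 (fibration_of_horn_fillers _ fun n k χ _ _ => ?_)
  have hR := isSmallFibration_classified χ
  have := hR.1
  -- Extend the classified fibration over the simplex, then cut it down to size `S` without changing
  -- it over the horn.
  obtain ⟨Y, e, t, he, hY⟩ := fibrationExtends_horn k ((classified χ).ι ≫ fst _ _)
  have hRS : SizeLE (classified χ) S := sizeLE_of_isSmallFibration hR fun m =>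
    (app_injective Λ[n + 1, k].ι m).countable
  obtain ⟨Z, hZ, hZe, hZS⟩ := exists_small_subfibration e t S hRS
    fun m => nonempty_embedding_of_countable _ S
  have hmt : Mono t := MorphismProperty.of_isPullback (P := MorphismProperty.monomorphisms _)
    hY.flip (MorphismProperty.monomorphisms.infer_property _)
  let t' : (classified χ : SSet.{u}) ⟶ Z := Subcomplex.lift t hZ
  have ht' : t' ≫ Z.ι = t := rfl
  have : Mono t' := mono_of_mono_fac ht'
  obtain ⟨d, hd⟩ := exists_labelling hZS
  -- The labels must restrict to the given ones over the horn, so that the new classifying map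
  -- extends `χ` strictly. Elsewhere they are injective.
  obtain ⟨c, hc₁, hc₂⟩ := exists_extension_cofree t' ((classified χ).ι ≫ snd _ _) d
  let q : (Z : SSet.{u}) ⟶ Δ[n + 1] ⊗ cofree S := lift (Z.ι ≫ e) c
  have hq : t' ≫ q = (classified χ).ι ≫ Λ[n + 1, k].ι ▷ _ := by
    ext1
    · exact hY.w
    · exact hc₁
  have hmem (m) (z : (Z : SSet.{u}).obj m) (x : (Λ[n + 1, k] : SSet.{u}).obj m)
      (h : (Z.ι ≫ e).app m z = Λ[n + 1, k].ι.app m x) : ∃ y, t'.app m y = z := by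
    obtain ⟨y, hy, -⟩ := exists_of_isPullback hY (Z.ι.app m z) x h
    exact ⟨y, app_injective Z.ι m hy⟩
  have hq' (m) (y : (classified χ : SSet.{u}).obj m) :
      q.app m (t'.app m y) = (Λ[n + 1, k].ι.app m y.1.1, y.1.2) := congr(($hq).app m y)
  have : Mono q := by
    apply mono_of_injective
    intro m z z' h
    have h₁ : (Z.ι ≫ e).app m z = (Z.ι ≫ e).app m z' := congr_arg Prod.fst h
    have h₂ : c.app m z = c.app m z' := congr_arg Prod.snd h
    have key (y : (classified χ : SSet.{u}).obj m) (z : (Z : SSet.{u}).obj m)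
        (h : (Z.ι ≫ e).app m (t'.app m y) = (Z.ι ≫ e).app m z) : ∃ y', t'.app m y' = z := by
      refine hmem m z y.1.1 (h.symm.trans ?_)
      exact congr_arg Prod.fst (hq' m y)
    by_cases hz : z ∈ Set.range (t'.app m)
    · obtain ⟨y, rfl⟩ := hz
      obtain ⟨y', rfl⟩ := key y z' h₁
      rw [hq', hq'] at h
      have : y = y' := Subtype.ext (Prod.ext
        (app_injective Λ[n + 1, k].ι m (congr_arg Prod.fst h))
        (congr_arg (fun z : (Δ[n + 1] ⊗ cofree S).obj m => z.2) h))
      rw [this]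
    by_cases hz' : z' ∈ Set.range (t'.app m)
    · obtain ⟨y, rfl⟩ := hz'
      exact (hz (key y z h₁.symm)).elim
    · apply hd m
      rw [← hc₂ m z hz, ← hc₂ m z' hz']
      exact congr_fun (congr_fun h₂ _) _
  have hQ := isSmallFibration_range (Z.ι ≫ e) c hZS
  refine ⟨classify hQ, hom_ext_of_classified_eq ?_, by subsingleton⟩
  rw [← preimage_classified_comp, classified_classify]
  ext m ⟨x, a⟩
  constructor
  · rintro ⟨z, hz⟩
    have hz' : q.app m z = (Λ[n + 1, k].ι.app m x, a) := hz
    obtain ⟨y, rfl⟩ := hmem m z x (congr_arg Prod.fst hz')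
    rw [hq'] at hz'
    obtain rfl := app_injective Λ[n + 1, k].ι m (congr_arg Prod.fst hz')
    obtain rfl : y.1.2 = a := congr_arg Prod.snd hz'
    exact y.2
  · intro h
    exact ⟨t'.app m ⟨(x, a), h⟩, hq' m ⟨(x, a), h⟩⟩

/-! ### Extension along anodyne maps, and acyclic Kan fibrations -/

/-- Kan fibrations extend along anodyne extensions. -/
lemma fibrationExtends_of_anodyne {A B X : SSet.{u}} {i : A ⟶ B} (hi : anodyneExtensions i)
    (x : X ⟶ A) [Fibration x] : FibrationExtends i x := by
  -- Large enough to label the simplices of `X`, and infinite so that the universe is Kan.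
  let S := ULift.{u} ℕ ⊕ Σ n, X.obj n
  have hX : SizeLE X S := fun n => ⟨⟨fun y => .inr ⟨n, y⟩, fun _ _ h => eq_of_heq (Sigma.mk.inj (Sum.inr.inj h)).2⟩⟩
  obtain ⟨d, hd⟩ := exists_labelling hX
  let c : X ⟶ cofree S := cofreeLift d
  have : Mono (lift x c) := by
    apply mono_of_injective
    intro n y y' h
    have := congr_arg (fun z => (z.2 : (cofree S).obj n) n.unop (𝟙 _)) h
    have h : cofreeLabel c n y = cofreeLabel c n y' := this
    rw [cofreeLabel_cofreeLift, cofreeLabel_cofreeLift] at h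
    exact hd n h
  have hR := isSmallFibration_range x c hX
  have hU := fibration_terminal_from _ (kanComplex_universalBase S)
  have := hasLiftingProperty_of_anodyne hi (terminal.from (universalBase S))
  have sq : CommSq (classify hR) i (terminal.from _) (terminal.from _) := ⟨by subsingleton⟩
  have hsq : classified (i ≫ sq.lift) = Subcomplex.range (lift x c) := by
    rw [sq.fac_left, classified_classify]
  have hχ := isSmallFibration_classified sq.lift
  rw [← preimage_classified_comp] at hsq
  let t : X ⟶ classified sq.lift := Subcomplex.lift (lift x c ≫ i ▷ _) (by
    rintro n _ ⟨y, rfl⟩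
    have h : (lift x c).app n y ∈ ((classified sq.lift).preimage (i ▷ _)).obj n := by
      rw [hsq]
      exact ⟨y, rfl⟩
    exact h)
  refine ⟨_, _, t, (isSmallFibration_classified sq.lift).1,
    isPullback_of_exists_of_injective rfl ?_ ?_⟩
  · rintro n ⟨⟨_, b⟩, h⟩ a rfl
    have h' : ((a, b) : (A ⊗ cofree S).obj n) ∈ ((classified sq.lift).preimage (i ▷ _)).obj n := h
    rw [hsq] at h'
    obtain ⟨y, hy⟩ := h'
    obtain rfl : x.app n y = a := congr_arg Prod.fst hy
    obtain rfl : c.app n y = b := congr_arg Prod.snd hy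
    exact ⟨y, rfl, rfl⟩
  · intro n y y' h h'
    exact app_injective (lift x c) n (Prod.ext h' (congr_arg (fun z => z.1.2) h))

/-- A Kan fibration which is a weak equivalence is a trivial fibration. -/
lemma trivFib_of_weakEquivalences {E B : SSet.{u}} (p : E ⟶ B) [Fibration p]
    (hp : weakEquivalences p) : TrivFib p := by
  obtain ⟨B', i, b, hi, hb, -⟩ := exists_anodyne_fibration (terminal.from B)
  have hB' : SSet.KanComplex B' := by
    refine (isFibrant_iff _).2 ?_
    have : terminal.from B' = b := by subsingleton
    rwa [this]
  obtain ⟨E', e', t, he', hE⟩ := fibrationExtends_of_anodyne hi p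
  obtain ⟨E'', a, π, ha, hπ, hfac⟩ := exists_anodyne_fibration (p ≫ i)
  -- `π` is a weak equivalence by two-out-of-three, and its base is Kan.
  have hπ' : TrivFib π := by
    refine trivFib_of_kanComplex π hB' ?_
    refine weakEquivalences_of_precomp (anodyneExtensions.weakEquivalences ha) ?_
    rw [hfac]
    exact weakEquivalences_comp hp (anodyneExtensions.weakEquivalences hi)
  have := hasLiftingProperty_of_anodyne ha e'
  have sq : CommSq t a e' π := ⟨by rw [hE.w, hfac]⟩
  have hk₁ : a ≫ sq.lift = t := sq.fac_left
  have hk₂ : sq.lift ≫ e' = π := sq.fac_right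
  obtain ⟨σ, hσ⟩ := hπ'.exists_section
  let s : B ⟶ E := hE.lift (i ≫ σ ≫ sq.lift) (𝟙 B)
    (by rw [Category.assoc, Category.assoc, hk₂, hσ, Category.comp_id, Category.id_comp])
  have hs₁ : s ≫ t = i ≫ σ ≫ sq.lift := hE.lift_fst _ _ _
  have hs₂ : s ≫ p = 𝟙 B := hE.lift_snd _ _ _
  -- This homotopy, moved to `E'` by `sq.lift`, stays over `B` and so pulls back to a fibrewise
  -- homotopy from `𝟙 E` to `p ≫ s`.
  have h : FibHomotopic π a (p ≫ i ≫ σ) := hπ'.fibHomotopic (by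
    rw [hfac, Category.assoc, Category.assoc, hσ, Category.comp_id])
  obtain ⟨H, h₀, h₁, h₂⟩ := h.postcomp sq.lift hk₂
  rw [Category.assoc, hk₂, hfac] at h₂
  refine trivFib_of_fibHomotopic p s hs₂ ⟨hE.lift H (fst _ _ ≫ p) (by rw [h₂, Category.assoc]),
    ?_, ?_, ?_⟩
  · apply hE.hom_ext
    · rw [Category.assoc, hE.lift_fst, h₀, hk₁, Category.id_comp]
    · rw [Category.assoc, hE.lift_snd, endpt_fst_assoc, Category.id_comp]
  · apply hE.hom_ext
    · rw [Category.assoc, hE.lift_fst, h₁, Category.assoc, Category.assoc, Category.assoc]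
      exact congr(p ≫ $hs₁).symm
    · rw [Category.assoc, hE.lift_snd, endpt_fst_assoc, Category.assoc, hs₂, Category.comp_id]
  · rw [hE.lift_snd, Category.id_comp]

lemma trivFib_iff {E B : SSet.{u}} (p : E ⟶ B) :
    TrivFib p ↔ kanFibrations p ∧ weakEquivalences p := by
  refine ⟨fun hp => ⟨?_, hp.weakEquivalences⟩, fun ⟨h₁, h₂⟩ => ?_⟩
  · have := hp.fibration
    rwa [fibration_iff] at this
  · have : Fibration p := by rwa [fibration_iff]
    exact trivFib_of_weakEquivalences p h₂

section

variable {C : Type u} [SmallCategory C]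

/-! ### Adjunctions and lifting properties -/

lemma hasLiftingProperty_pushoutProduct_iff {F G A B P Q : SPre C} (f : F ⟶ G) (g : A ⟶ B)
    (p : P ⟶ Q) :
    HasLiftingProperty (pushoutProduct f g) p ↔ HasLiftingProperty g (homPullback f p) :=
  (MonoidalClosed.internalHomAdjunction₂ (C := SPre C)).hasLiftingProperty_iff
    (Functor.PushoutObjObj.ofHasPushout (curriedTensor (SPre C)) f g)
    (Functor.PullbackObjObj.ofHasPullback MonoidalClosed.internalHom f p)

variable (C) in
/-- The functor sending `F` and `K` to the tensor of `F` with `K`. -/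
def tensorFunctor : SPre C ⥤ SSet.{u} ⥤ SPre C :=
  curriedTensor (SPre C) ⋙ (Functor.whiskeringLeft _ _ _).obj (constant C)

lemma whiskerLeft_constant_map_stdSimplex {F G : SPre C} {K : SSet.{u}} {n m : SimplexCategory}
    (φ : m ⟶ n) (k : K.obj (op n)) (f : F ⊗ (constant C).obj K ⟶ G) :
    F ◁ (constant C).map (SSet.yonedaEquiv.symm (K.map φ.op k)) ≫ f =
      F ◁ (constant C).map (SSet.stdSimplex.map φ) ≫
        F ◁ (constant C).map (SSet.yonedaEquiv.symm k) ≫ f := by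
  rw [← SSet.yonedaEquiv_symm_naturality_left, Functor.map_comp, MonoidalCategory.whiskerLeft_comp,
    Category.assoc]

/-- The map `K ⟶ Map F G` corresponding to `F ⊗ K ⟶ G`. -/
def tensorCurry {F : SPre C} {K : SSet.{u}} {G : SPre C} (f : F ⊗ (constant C).obj K ⟶ G) :
    K ⟶ Map F G where
  app _ := ↾fun k => F ◁ (constant C).map (SSet.yonedaEquiv.symm k) ≫ f
  naturality _ _ φ := ConcreteCategory.hom_ext _ _ fun k =>
    whiskerLeft_constant_map_stdSimplex φ.unop k f

lemma tensorUncurry_aux {F : SPre C} {K : SSet.{u}} {G : SPre C} (φ : K ⟶ Map F G) {n n'}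
    (f : n ⟶ n') (k : K.obj n) :
    (φ.app n' (K.map f k) : F ⊗ (constant C).obj (SSet.stdSimplex.obj n'.unop) ⟶ G) =
      F ◁ (constant C).map (SSet.stdSimplex.map f.unop) ≫ φ.app n k :=
  congr(($(φ.naturality f)) k)

/-- The map `F ⊗ K ⟶ G` corresponding to `K ⟶ Map F G`. -/
def tensorUncurry {F : SPre C} {K : SSet.{u}} {G : SPre C} (φ : K ⟶ Map F G) :
    F ⊗ (constant C).obj K ⟶ G where
  app X :=
    { app n := ↾fun z => (NatTrans.app (φ.app n z.2) X).app n
        (z.1, stdSimplex.objEquiv.symm (𝟙 n.unop))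
      naturality n n' f := by
        refine ConcreteCategory.hom_ext _ _ fun z => ?_
        have h₁ := tensorUncurry_aux φ f z.2
        have h₂ := congr(($((NatTrans.app (φ.app n z.2) X).naturality f))
          (z.1, stdSimplex.objEquiv.symm (𝟙 n.unop)))
        refine Eq.trans ?_ h₂
        change (NatTrans.app (φ.app n' (K.map f z.2)) X).app n' _ = _
        rw [h₁]
        rfl }
  naturality X Y f := by
    ext n z
    exact congr(($((φ.app n z.2 : F ⊗ (constant C).obj _ ⟶ G).naturality f)).app n
      (z.1, stdSimplex.objEquiv.symm (𝟙 n.unop)))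

/-- Maps `F ⊗ K ⟶ G` correspond to maps `K ⟶ Map F G`. -/
def tensorHomEquiv (F : SPre C) (K : SSet.{u}) (G : SPre C) :
    (F ⊗ (constant C).obj K ⟶ G) ≃ (K ⟶ Map F G) where
  toFun := tensorCurry
  invFun := tensorUncurry
  left_inv f := by
    ext X n z
    change (f.app X).app n (z.1, K.map (𝟙 n) z.2) = (f.app X).app n z
    rw [K.map_id]
    rfl
  right_inv φ := by
    ext n k
    refine NatTrans.ext (funext fun X => NatTrans.ext (funext fun m =>
      ConcreteCategory.hom_ext _ _ fun z => ?_))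
    obtain ⟨x, y⟩ := z
    obtain ⟨f, rfl⟩ := stdSimplex.objEquiv.symm.surjective y
    change (NatTrans.app (φ.app m (K.map f.op k)) X).app m _ = _
    have h := tensorUncurry_aux φ f.op k
    refine (congr((NatTrans.app $h X).app m (x, stdSimplex.objEquiv.symm (𝟙 m.unop)))).trans ?_
    change (NatTrans.app (φ.app n k) X).app m (x, stdSimplex.objEquiv.symm (𝟙 m.unop ≫ f)) = _
    rw [Category.id_comp]
    rfl

variable (C) in
/-- The adjunction between tensors and mapping spaces. -/
def tensorAdjunction : tensorFunctor C ⊣₂ mapFunctor C :=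
  .mk' (fun F => Adjunction.mkOfHomEquiv
    { homEquiv K G := tensorHomEquiv F K G
      homEquiv_naturality_left_symm _ _ := rfl
      homEquiv_naturality_right _ _ := rfl }) (by
    intro F F' f K G g
    rw [Adjunction.mkOfHomEquiv_homEquiv, Adjunction.mkOfHomEquiv_homEquiv]
    rfl)

lemma hasLiftingProperty_pushoutProduct_constant_iff {A B P Q : SPre C} (i : A ⟶ B)
    {K L : SSet.{u}} (g : K ⟶ L) (p : P ⟶ Q) :
    HasLiftingProperty (pushoutProduct i ((constant C).map g)) p ↔
      HasLiftingProperty g (mapPullback i p) := by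
  have : HasPushout (((tensorFunctor C).map i).app K) (((tensorFunctor C).obj A).map g) :=
    inferInstance
  exact (tensorAdjunction C).hasLiftingProperty_iff
    (Functor.PushoutObjObj.ofHasPushout (tensorFunctor C) i g)
    (Functor.PullbackObjObj.ofHasPullback (mapFunctor C) i p)

end

section

/-! ### The small object argument for simplicial presheaves -/

instance : IsLocallyPresentable.{u} SSet.{u} := by
  -- `SimplexCategory` lives in universe `0`; `AsSmall` moves it to `u`.
  have : IsLocallyPresentable.{u} ((AsSmall.{u} SimplexCategory)ᵒᵖ ⥤ Type u) := inferInstance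
  exact (((AsSmall.equiv (C := SimplexCategory)).symm.op).congrLeft
    (E := Type u)).isLocallyPresentable

variable {C : Type u} [SmallCategory C]

lemma exists_isCardinalPresentable {I : Type u} (A : I → SPre C) :
    ∃ (κ : Cardinal.{u}) (_ : Fact κ.IsRegular), ∀ i, IsCardinalPresentable (A i) κ := by
  have h (i) : ∃ (κ : Cardinal.{u}) (_ : Fact κ.IsRegular), IsCardinalPresentable (A i) κ :=
    (inferInstance : IsPresentable.{u} (A i)).exists_cardinal
  choose κ hκ hA using h
  -- The successor of an infinite cardinal is regular and bounds all the `κ i` at once.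
  let κ' := max Cardinal.aleph0 (iSup κ)
  have : Fact (Order.succ κ').IsRegular := ⟨Cardinal.isRegular_succ (le_max_left _ _)⟩
  refine ⟨Order.succ κ', this, fun i => ?_⟩
  have := hA i
  exact isCardinalPresentable_of_le (A i) (κ := κ i)
    (((le_ciSup Cardinal.bddAbove_of_small i).trans (le_max_right _ _)).trans (Order.le_succ κ'))

lemma hasSmallObjectArgument (W : MorphismProperty (SPre C)) [MorphismProperty.IsSmall.{u} W] :
    MorphismProperty.HasSmallObjectArgument.{u} W := by
  obtain ⟨κ, hκ, h⟩ := exists_isCardinalPresentable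
    (fun i : Shrink.{u} W.toSet => ((equivShrink _).symm i).1.left)
  have : Nonempty κ.ord.ToType := by
    rw [Ordinal.nonempty_toType_iff, ne_eq, Cardinal.ord_eq_zero]
    exact hκ.out.pos.ne'
  let _ : OrderBot κ.ord.ToType := WellFoundedLT.toOrderBot κ.ord.ToType
  refine ⟨κ, hκ, inferInstance, { preservesColimit := fun {A B X Y} i hi f hf => ?_ }⟩
  have : IsCardinalPresentable A κ := by
    have := h (equivShrink _ ⟨Arrow.mk i, hi⟩)
    rwa [Equiv.symm_apply_apply] at this
  have := preservesColimitsOfShape_of_isCardinalPresentable A κ κ.ord.ToType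
  infer_instance

instance : MorphismProperty.IsSmall.{u} (generatingAcyclicCofibrations C) where
  small_toSet := by
    let I := (Σ (X : C) (n : ℕ) (U : Fin n → C), {i : ∀ a, U a ⟶ X // ∀ a, Mono (i a)}) ×
      (J.{u}).toSet
    let φ (x : I) : (generatingAcyclicCofibrations C).toSet := ⟨Arrow.mk _, .mk x.1.2.2.2.1
      x.1.2.2.2.2 x.2.1.hom x.2.2⟩
    refine small_of_surjective (f := φ) ?_
    rintro ⟨⟨_, _, f⟩, @⟨X, n, U, K, L, i, hi, g, hg⟩⟩
    exact ⟨⟨⟨X, n, U, i, hi⟩, ⟨Arrow.mk g, hg⟩⟩, rfl⟩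

/-- Every map factors as a map with the left lifting property with respect to flasque fibrations
followed by a flasque fibration. -/
lemma exists_factorization_flasqueFibrations {F G : SPre C} (f : F ⟶ G) :
    ∃ (H : SPre C) (i : F ⟶ H) (p : H ⟶ G), (flasqueFibrations C).llp i ∧
      flasqueFibrations C p ∧ i ≫ p = f := by
  have := hasSmallObjectArgument (generatingAcyclicCofibrations C)
  let h := MorphismProperty.factorizationData ((generatingAcyclicCofibrations C).rlp.llp)
    (generatingAcyclicCofibrations C).rlp f
  exact ⟨h.Z, h.i, h.p, h.hi, h.hp, h.fac⟩

end

section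

/-! ### Pushout products of injective maps -/

lemma injective_and_range_pushoutProduct {F G A B P : Type u} {f : F → G} {g : A → B}
    {l : G × A → P} {r : F × B → P} (hlr : ∀ z, (∃ x, l x = z) ∨ ∃ y, r y = z)
    (w : ∀ x a, l (f x, a) = r (x, g a)) {ι : P → G × B} (hl : ∀ y a, ι (l (y, a)) = (y, g a))
    (hr : ∀ x b, ι (r (x, b)) = (f x, b)) (hf : Function.Injective f) (hg : Function.Injective g) :
    Function.Injective ι ∧ ∀ z, z ∈ Set.range ι ↔ z.1 ∈ Set.range f ∨ z.2 ∈ Set.range g := by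
  constructor
  · intro z z' h
    obtain ⟨⟨y, a⟩, rfl⟩ | ⟨⟨x, b⟩, rfl⟩ := hlr z <;>
    obtain ⟨⟨y', a'⟩, rfl⟩ | ⟨⟨x', b'⟩, rfl⟩ := hlr z'
    · rw [hl, hl, Prod.mk.injEq] at h
      rw [h.1, hg h.2]
    · rw [hl, hr, Prod.mk.injEq] at h
      rw [h.1, ← h.2, w]
    · rw [hl, hr, Prod.mk.injEq] at h
      rw [← h.1, h.2, w]
    · rw [hr, hr, Prod.mk.injEq] at h
      rw [hf h.1, h.2]
  · rintro ⟨y, b⟩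
    constructor
    · rintro ⟨z, hz⟩
      obtain ⟨⟨y', a'⟩, rfl⟩ | ⟨⟨x', b'⟩, rfl⟩ := hlr z
      · rw [hl, Prod.mk.injEq] at hz
        exact .inr ⟨a', hz.2⟩
      · rw [hr, Prod.mk.injEq] at hz
        exact .inl ⟨x', hz.1⟩
    · rintro (⟨x, hx⟩ | ⟨a, ha⟩)
      · exact ⟨r (x, b), by rw [hr]; exact Prod.ext hx rfl⟩
      · exact ⟨l (y, a), by rw [hl]; exact Prod.ext rfl ha⟩

variable {C : Type u} [SmallCategory C]

/-- The maps of simplicial presheaves that are injective on simplices. -/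
def Injective {F G : SPre C} (f : F ⟶ G) : Prop :=
  ∀ X n, Function.Injective ((f.app X).app n)

/-- The set of simplices in the image of a map of simplicial presheaves. -/
def range {F G : SPre C} (f : F ⟶ G) (X : Cᵒᵖ) (n : SimplexCategoryᵒᵖ) : Set ((G.obj X).obj n) :=
  Set.range ((f.app X).app n)

lemma pushoutProduct_aux {F G A B : SPre C} {f : F ⟶ G} {g : A ⟶ B} (hf : Injective f)
    (hg : Injective g) (X n) : Function.Injective (((pushoutProduct f g).app X).app n) ∧
      ∀ z, z ∈ range (pushoutProduct f g) X n ↔ z.1 ∈ range f X n ∨ z.2 ∈ range g X n :=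
  injective_and_range_pushoutProduct (f := (f.app X).app n) (g := (g.app X).app n)
    (l := ((pushout.inl (f ▷ A) (F ◁ g)).app X).app n)
    (r := ((pushout.inr (f ▷ A) (F ◁ g)).app X).app n)
    (fun z => exists_of_isPushout (IsPushout.of_hasPushout (f ▷ A) (F ◁ g))
      ((evaluation _ _).obj X ⋙ (evaluation _ (Type u)).obj n) z)
    (fun x a => congr((($(pushout.condition (f := f ▷ A) (g := F ◁ g))).app X).app n (x, a)))
    (fun y a => congr((($(pushout.inl_desc (G ◁ g) (f ▷ B) (whisker_exchange f g).symm)).app X).app n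
      (y, a)))
    (fun x b => congr((($(pushout.inr_desc (G ◁ g) (f ▷ B) (whisker_exchange f g).symm)).app X).app n
      (x, b))) (hf X n) (hg X n)

lemma Injective.pushoutProduct {F G A B : SPre C} {f : F ⟶ G} {g : A ⟶ B} (hf : Injective f)
    (hg : Injective g) : Injective (pushoutProduct f g) :=
  fun X n => (pushoutProduct_aux hf hg X n).1

lemma mem_range_pushoutProduct {F G A B : SPre C} {f : F ⟶ G} {g : A ⟶ B} (hf : Injective f)
    (hg : Injective g) {X n} (z : ((G ⊗ B).obj X).obj n) :
    z ∈ range (pushoutProduct f g) X n ↔ z.1 ∈ range f X n ∨ z.2 ∈ range g X n :=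
  (pushoutProduct_aux hf hg X n).2 z

lemma mem_range_pushoutObjObj {K L M N : SSet.{u}} {f : K ⟶ L} {g : M ⟶ N} [Mono f] [Mono g]
    (sq : (curriedTensor SSet.{u}).PushoutObjObj f g) {n} (z : (L ⊗ N).obj n) :
    z ∈ Set.range (sq.ι.app n) ↔ z.1 ∈ Set.range (f.app n) ∨ z.2 ∈ Set.range (g.app n) :=
  (injective_and_range_pushoutProduct (f := f.app n) (g := g.app n) (l := sq.inl.app n)
    (r := sq.inr.app n)
    (fun z => exists_of_isPushout sq.isPushout ((evaluation _ (Type u)).obj n) z)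
    (fun k x => congr(($(sq.isPushout.w)).app n (k, x)))
    (fun l x => congr(($(sq.inl_ι)).app n (l, x)))
    (fun k y => congr(($(sq.inr_ι)).app n (k, y)))
    (app_injective f n) (app_injective g n)).2 z

lemma injective_constant {K L : SSet.{u}} (g : K ⟶ L) [Mono g] :
    Injective ((constant C).map g) := fun _ n => app_injective g n

lemma Injective.exists_factor {A A' B : SPre C} {m : A' ⟶ B} (hm : Injective m) (f : A ⟶ B)
    (h : ∀ X n, range f X n ⊆ range m X n) : ∃ a : A ⟶ A', a ≫ m = f := by
  have h' (X n) (x : (A.obj X).obj n) : ∃ y, (m.app X).app n y = (f.app X).app n x := h X n ⟨x, rfl⟩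
  choose a ha using h'
  refine ⟨{ app X := { app n := ↾(a X n), naturality n n' φ := ?_ }, naturality X X' φ := ?_ }, ?_⟩
  · refine ConcreteCategory.hom_ext _ _ fun x => hm X n' ?_
    refine (ha X n' _).trans ((congr(($((f.app X).naturality φ)) x)).trans ?_)
    refine Eq.trans ?_ (congr(($((m.app X).naturality φ)) (a X n x))).symm
    exact congr_arg _ (ha X n x).symm
  · ext n x
    refine hm X' n ?_
    refine (ha X' n _).trans ((congr((($(f.naturality φ)).app n) x)).trans ?_)
    refine Eq.trans ?_ (congr((($(m.naturality φ)).app n) (a X n x))).symm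
    exact congr_arg _ (ha X n x).symm
  · ext X n x
    exact ha X n x

lemma Injective.mono {A B : SPre C} {m : A ⟶ B} (hm : Injective m) : Mono m := by
  have (X : Cᵒᵖ) : Mono (m.app X) := mono_of_injective _ (hm X)
  exact NatTrans.mono_of_mono_app _

/-- Injective maps with the same range have the same lifting properties. -/
lemma Injective.hasLiftingProperty_of_range {A B A' B' P Q : SPre C} {m : A ⟶ B} {m' : A' ⟶ B'}
    (hm : Injective m) (hm' : Injective m') (e : B ≅ B')
    (h : ∀ X n b, b ∈ range m X n ↔ (e.hom.app X).app n b ∈ range m' X n) (p : P ⟶ Q)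
    (hp : HasLiftingProperty m p) : HasLiftingProperty m' p := by
  have he (X n) (b : (B'.obj X).obj n) : (e.hom.app X).app n ((e.inv.app X).app n b) = b :=
    congr((($(e.inv_hom_id)).app X).app n b)
  obtain ⟨a, ha⟩ := hm'.exists_factor (m ≫ e.hom) (by
    rintro X n _ ⟨x, rfl⟩
    exact (h X n _).1 ⟨x, rfl⟩)
  obtain ⟨b, hb⟩ := hm.exists_factor (m' ≫ e.inv) (by
    rintro X n _ ⟨x, rfl⟩
    refine (h X n _).2 ?_
    have := he X n ((m'.app X).app n x)
    exact ⟨x, this.symm⟩)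
  have := hm.mono
  have := hm'.mono
  let i : A ≅ A' :=
    { hom := a
      inv := b
      hom_inv_id := by
        rw [← cancel_mono m, Category.assoc, hb, reassoc_of% ha, e.hom_inv_id, Category.comp_id,
          Category.id_comp]
      inv_hom_id := by
        rw [← cancel_mono m', Category.assoc, ha, reassoc_of% hb, e.inv_hom_id, Category.comp_id,
          Category.id_comp] }
  exact HasLiftingProperty.of_arrow_iso_left (Arrow.isoMk i e ha) p

/-! ### Unions of monomorphisms -/

section Union

variable {X : C} {n : ℕ} {U : Fin n → C} (i : ∀ a, U a ⟶ X)

/-- The map of simplicial presheaves `∪ U ⟶ X`. -/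
abbrev unionInclusion : (discrete C).obj (union i) ⟶ (discrete C).obj (yoneda.obj X) :=
  (discrete C).map (unionMap i)

/-- The inclusion of a member of the collection in its union. -/
def toUnion (a : Fin n) : yoneda.obj (U a) ⟶ union i :=
  Sigma.ι (fun a => yoneda.obj (U a)) a ≫ coequalizer.π (unionFst i) (unionSnd i)

lemma toUnion_unionMap (a : Fin n) : toUnion i a ≫ unionMap i = yoneda.map (i a) := by
  have h : coequalizer.π (unionFst i) (unionSnd i) ≫ unionMap i =
    Sigma.desc fun a => yoneda.map (i a) := coequalizer.π_desc _ _
  have h' := Sigma.ι (fun a => yoneda.obj (U a)) a ≫= h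
  rw [Sigma.ι_desc] at h'
  exact (Category.assoc _ _ _).trans h'

lemma toUnion_condition (a b : Fin n) :
    pullback.fst (yoneda.map (i a)) (yoneda.map (i b)) ≫ toUnion i a =
      pullback.snd (yoneda.map (i a)) (yoneda.map (i b)) ≫ toUnion i b := by
  have h := Sigma.ι (fun p : Fin n × Fin n =>
    pullback (yoneda.map (i p.1)) (yoneda.map (i p.2))) (a, b) ≫=
      coequalizer.condition (unionFst i) (unionSnd i)
  rw [unionFst, unionSnd, Sigma.ι_desc_assoc, Sigma.ι_desc_assoc] at h
  rw [Category.assoc, Category.assoc] at h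
  exact h

lemma exists_toUnion_eq (Y : Cᵒᵖ) (z : (union i).obj Y) :
    ∃ (a : Fin n) (u : (yoneda.obj (U a)).obj Y), (toUnion i a).app Y u = z := by
  have h : Epi ((coequalizer.π (unionFst i) (unionSnd i)).app Y) := inferInstance
  obtain ⟨z, rfl⟩ := (epi_iff_surjective _).1 h z
  obtain ⟨⟨a⟩, u, rfl⟩ := Types.jointly_surjective_of_isColimit
    (isColimitOfPreserves ((evaluation _ (Type u)).obj Y)
      (colimit.isColimit (Discrete.functor fun a => yoneda.obj (U a)))) z
  exact ⟨a, u, rfl⟩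

lemma unionMap_toUnion {a : Fin n} {Y : Cᵒᵖ} (u : (yoneda.obj (U a)).obj Y) :
    (unionMap i).app Y ((toUnion i a).app Y u) = (yoneda.map (i a)).app Y u :=
  congr(($(toUnion_unionMap i a)).app Y u)

/-- Sections of `U a` and `U b` with the same image in `X` come from `U a ×_X U b`, so the
coequalizer identifies them. -/
lemma injective_unionInclusion : Injective (unionInclusion i) := by
  intro Y m (z : (union i).obj Y) (z' : (union i).obj Y) h
  replace h : (unionMap i).app Y z = (unionMap i).app Y z' := h
  obtain ⟨a, u, rfl⟩ := exists_toUnion_eq i Y z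
  obtain ⟨b, v, rfl⟩ := exists_toUnion_eq i Y z'
  rw [unionMap_toUnion, unionMap_toUnion] at h
  obtain ⟨w, rfl, rfl⟩ := Types.exists_of_isPullback ((IsPullback.of_hasPullback (yoneda.map (i a))
    (yoneda.map (i b))).map ((evaluation _ (Type u)).obj Y)) u v h
  exact congr(($(toUnion_condition i a b)).app Y w)

lemma mem_range_unionInclusion {Y : Cᵒᵖ} {m} (z : Y.unop ⟶ X) :
    (z : (((discrete C).obj (yoneda.obj X)).obj Y).obj m) ∈ range (unionInclusion i) Y m ↔
      ∃ (a : Fin n) (u : Y.unop ⟶ U a), u ≫ i a = z := by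
  constructor
  · rintro ⟨(x : (union i).obj Y), hx⟩
    obtain ⟨a, u, rfl⟩ := exists_toUnion_eq i Y x
    exact ⟨a, u, (unionMap_toUnion i u).symm.trans hx⟩
  · rintro ⟨a, u, rfl⟩
    exact ⟨(toUnion i a).app Y u, unionMap_toUnion i u⟩

end Union

/-! ### Pushout products of generating cofibrations -/

/-- The family is `U a ⨯ Y` together with `X ⨯ V b`: it generates `(∪ U × Y) ∪ (X × ∪ V)`. -/
lemma exists_prod_union [HasFiniteProducts C] {X Y : C} {n m : ℕ} {U : Fin n → C} {V : Fin m → C}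
    (i : ∀ a, U a ⟶ X) (j : ∀ b, V b ⟶ Y) (hi : ∀ a, Mono (i a)) (hj : ∀ b, Mono (j b)) :
    ∃ (W : Fin (n + m) → C) (k : ∀ c, W c ⟶ X ⨯ Y), (∀ c, Mono (k c)) ∧
      ∀ {Z : C} (z : Z ⟶ X ⨯ Y), (∃ c u, u ≫ k c = z) ↔
        (∃ a u, u ≫ i a = z ≫ prod.fst) ∨ ∃ b u, u ≫ j b = z ≫ prod.snd := by
  let W (c : Fin n ⊕ Fin m) : C := c.elim (fun a => U a ⨯ Y) (fun b => X ⨯ V b)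
  let k (c : Fin n ⊕ Fin m) : W c ⟶ X ⨯ Y := match c with
    | .inl a => prod.map (i a) (𝟙 Y)
    | .inr b => prod.map (𝟙 X) (j b)
  refine ⟨fun c => W (finSumFinEquiv.symm c), fun c => k (finSumFinEquiv.symm c), fun c => ?_,
    fun {Z} z => ⟨?_, ?_⟩⟩
  · have (c : Fin n ⊕ Fin m) : Mono (k c) := by
      obtain a | b := c
      · exact inferInstanceAs (Mono (prod.map (i a) (𝟙 Y)))
      · exact inferInstanceAs (Mono (prod.map (𝟙 X) (j b)))
    exact this _
  · have key₁ (a : Fin n) (u : Z ⟶ U a ⨯ Y) :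
        (u ≫ prod.fst) ≫ i a = (u ≫ prod.map (i a) (𝟙 Y)) ≫ prod.fst := by simp
    have key₂ (b : Fin m) (u : Z ⟶ X ⨯ V b) :
        (u ≫ prod.snd) ≫ j b = (u ≫ prod.map (𝟙 X) (j b)) ≫ prod.snd := by simp
    have key (c : Fin n ⊕ Fin m) (u : Z ⟶ W c) (h : u ≫ k c = z) :
        (∃ a u, u ≫ i a = z ≫ prod.fst) ∨ ∃ b u, u ≫ j b = z ≫ prod.snd := by
      subst h
      obtain a | b := c
      · exact .inl ⟨a, _, key₁ a u⟩
      · exact .inr ⟨b, _, key₂ b u⟩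
    rintro ⟨c, u, h⟩
    exact key _ u h
  · have key (c : Fin n ⊕ Fin m) (u : Z ⟶ W c) (h : u ≫ k c = z) :
        ∃ (c : Fin (n + m)) (u : Z ⟶ W (finSumFinEquiv.symm c)),
          u ≫ k (finSumFinEquiv.symm c) = z := by
      obtain ⟨c, rfl⟩ := finSumFinEquiv.symm.surjective c
      exact ⟨c, u, h⟩
    rintro (⟨a, u, h⟩ | ⟨b, u, h⟩)
    · refine key (.inl a) (prod.lift u (z ≫ prod.snd)) ?_
      change prod.lift u (z ≫ prod.snd) ≫ prod.map (i a) (𝟙 Y) = z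
      exact Limits.prod.hom_ext (by rw [Category.assoc, prod.map_fst, prod.lift_fst_assoc, h])
        (by rw [Category.assoc, prod.map_snd, prod.lift_snd_assoc, Category.comp_id])
    · refine key (.inr b) (prod.lift (z ≫ prod.fst) u) ?_
      change prod.lift (z ≫ prod.fst) u ≫ prod.map (𝟙 X) (j b) = z
      exact Limits.prod.hom_ext
        (by rw [Category.assoc, prod.map_fst, prod.lift_fst_assoc, Category.comp_id])
        (by rw [Category.assoc, prod.map_snd, prod.lift_snd_assoc, h])

/-- The tensor of representables with simplicial sets is compatible with products. -/
def prodTensorIso [HasFiniteProducts C] (X Y : C) (K L : SSet.{u}) :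
    ((discrete C).obj (yoneda.obj (X ⨯ Y))) ⊗ (constant C).obj (K ⊗ L) ≅
      ((discrete C).obj (yoneda.obj X) ⊗ (constant C).obj K) ⊗
        ((discrete C).obj (yoneda.obj Y) ⊗ (constant C).obj L) :=
  NatIso.ofComponents (fun Z => NatIso.ofComponents (fun n => Equiv.toIso
    { toFun z := (((show unop Z ⟶ X ⨯ Y from z.1) ≫ prod.fst, z.2.1),
        ((show unop Z ⟶ X ⨯ Y from z.1) ≫ prod.snd, z.2.2))
      invFun z := (prod.lift (show unop Z ⟶ X from z.1.1) (show unop Z ⟶ Y from z.2.1),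
        (z.1.2, z.2.2))
      left_inv := by
        rintro ⟨z, k, l⟩
        exact congr_arg (fun z => (z, (k, l))) (Limits.prod.hom_ext (prod.lift_fst _ _)
          (prod.lift_snd _ _))
      right_inv := by
        rintro ⟨⟨x, k⟩, ⟨y, l⟩⟩
        have h₁ := prod.lift_fst (show unop Z ⟶ X from x) (show unop Z ⟶ Y from y)
        have h₂ := prod.lift_snd (show unop Z ⟶ X from x) (show unop Z ⟶ Y from y)
        exact congrArg₂ (fun x y => ((x, k), (y, l))) h₁ h₂ })
      (fun f => ConcreteCategory.hom_ext _ _ fun z => rfl))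
    (fun f => by
      ext n ⟨z, k, l⟩
      have h₁ := Category.assoc f.unop (show _ ⟶ X ⨯ Y from z) prod.fst
      have h₂ := Category.assoc f.unop (show _ ⟶ X ⨯ Y from z) prod.snd
      exact congrArg₂ (fun x y => ((x, k), (y, l))) h₁ h₂)

/-- The pushout product of a union of monomorphisms with a map of simplicial sets. -/
abbrev unionProduct {X : C} {n : ℕ} {U : Fin n → C} (i : ∀ a, U a ⟶ X) {K L : SSet.{u}}
    (g : K ⟶ L) :=
  pushoutProduct (unionInclusion i) ((constant C).map g)

lemma injective_unionProduct {X : C} {n : ℕ} {U : Fin n → C} (i : ∀ a, U a ⟶ X) {K L : SSet.{u}}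
    (g : K ⟶ L) [Mono g] : Injective (unionProduct i g) :=
  (injective_unionInclusion i).pushoutProduct (injective_constant g)

lemma mem_range_unionProduct {X : C} {n : ℕ} {U : Fin n → C} (i : ∀ a, U a ⟶ X) {K L : SSet.{u}}
    (g : K ⟶ L) [Mono g] {Z : Cᵒᵖ} {m} (z : Z.unop ⟶ X) (l : L.obj m) :
    ((z, l) : ((((discrete C).obj (yoneda.obj X)) ⊗ (constant C).obj L).obj Z).obj m) ∈
      range (unionProduct i g) Z m ↔
      (∃ (a : Fin n) (u : Z.unop ⟶ U a), u ≫ i a = z) ∨ l ∈ Set.range (g.app m) :=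
  (mem_range_pushoutProduct (injective_unionInclusion i) (injective_constant g) _).trans
    (or_congr_left (mem_range_unionInclusion i z))

/-- The pushout product of two maps of the form `unionProduct` is again of this form. -/
lemma hasLiftingProperty_pushoutProduct_unionProduct [HasFiniteProducts C] {X Y : C} {n m : ℕ}
    {U : Fin n → C} {V : Fin m → C} (i : ∀ a, U a ⟶ X) (j : ∀ b, V b ⟶ Y)
    (hi : ∀ a, Mono (i a)) (hj : ∀ b, Mono (j b)) {K L M N : SSet.{u}} (g : K ⟶ L) (h : M ⟶ N)
    [Mono g] [Mono h] {P Q : SPre C} (p : P ⟶ Q)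
    (H : ∀ (W : Fin (n + m) → C) (k : ∀ c, W c ⟶ X ⨯ Y), (∀ c, Mono (k c)) →
      HasLiftingProperty (unionProduct k
        (Functor.PushoutObjObj.ofHasPushout (curriedTensor SSet.{u}) g h).ι) p) :
    HasLiftingProperty (pushoutProduct (unionProduct i g) (unionProduct j h)) p := by
  obtain ⟨W, k, hk, hk'⟩ := exists_prod_union i j hi hj
  have := mono_pushoutObjObj_ι (Functor.PushoutObjObj.ofHasPushout (curriedTensor SSet.{u}) g h)
  have hg := injective_unionProduct i g
  have hh := injective_unionProduct j h
  refine (injective_unionProduct k _).hasLiftingProperty_of_range (hg.pushoutProduct hh)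
    (prodTensorIso X Y L N) ?_ p (H W k hk)
  rintro Z d ⟨z, l, l'⟩
  rw [mem_range_pushoutProduct hg hh]
  refine (mem_range_unionProduct k _ _ _).trans ?_
  refine (or_congr (hk' _) (mem_range_pushoutObjObj _ _)).trans ?_
  refine Iff.trans ?_ (or_congr (mem_range_unionProduct i g _ _)
    (mem_range_unionProduct j h _ _)).symm
  exact or_or_or_comm

end

section

variable {C : Type u} [SmallCategory C]

/-! ### Symmetry of the pushout product -/

/-- Isomorphisms exchanging the legs of two spans induce an isomorphism of maps out of the
pushouts. -/
def pushoutDescSymmetry {D : Type*} [Category D] [HasPushouts D] {S S' L L' R R' T T' : D}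
    {f : S ⟶ L} {g : S ⟶ R} {h : L ⟶ T} {k : R ⟶ T} (w : f ≫ h = g ≫ k)
    {f' : S' ⟶ L'} {g' : S' ⟶ R'} {h' : L' ⟶ T'} {k' : R' ⟶ T'} (w' : f' ≫ h' = g' ≫ k')
    (eS : S ≅ S') (eL : L ≅ R') (eR : R ≅ L') (eT : T ≅ T') (hf : f ≫ eL.hom = eS.hom ≫ g')
    (hg : g ≫ eR.hom = eS.hom ≫ f') (hh : eL.hom ≫ k' = h ≫ eT.hom)
    (hk : eR.hom ≫ h' = k ≫ eT.hom) :
    Arrow.mk (pushout.desc h k w) ≅ Arrow.mk (pushout.desc h' k' w') :=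
  have hf' : g' ≫ eL.inv = eS.inv ≫ f := by
    rw [Iso.comp_inv_eq, Category.assoc, hf, Iso.inv_hom_id_assoc]
  have hg' : f' ≫ eR.inv = eS.inv ≫ g := by
    rw [Iso.comp_inv_eq, Category.assoc, hg, Iso.inv_hom_id_assoc]
  Arrow.isoMk
    { hom := pushout.desc (eL.hom ≫ pushout.inr _ _) (eR.hom ≫ pushout.inl _ _) (by
        rw [reassoc_of% hf, reassoc_of% hg, pushout.condition])
      inv := pushout.desc (eR.inv ≫ pushout.inr _ _) (eL.inv ≫ pushout.inl _ _) (by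
        rw [reassoc_of% hf', reassoc_of% hg', pushout.condition])
      hom_inv_id := by
        apply pushout.hom_ext <;> simp [pushout.inl_desc_assoc, pushout.inr_desc_assoc,
          pushout.inl_desc, pushout.inr_desc]
      inv_hom_id := by
        apply pushout.hom_ext <;> simp [pushout.inl_desc_assoc, pushout.inr_desc_assoc,
          pushout.inl_desc, pushout.inr_desc] }
    eT (by
      apply pushout.hom_ext <;> simp [pushout.inl_desc_assoc, pushout.inr_desc_assoc,
        pushout.inl_desc, pushout.inr_desc, hh, hk])

/-- The symmetry of the pushout product. -/
def pushoutProductSymmetry {F G A B : SPre C} (f : F ⟶ G) (g : A ⟶ B) :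
    Arrow.mk (pushoutProduct f g) ≅ Arrow.mk (pushoutProduct g f) :=
  pushoutDescSymmetry _ _ (β_ F A) (β_ G A) (β_ F B) (β_ G B)
    (BraidedCategory.braiding_naturality_left f A) (BraidedCategory.braiding_naturality_right F g)
    (BraidedCategory.braiding_naturality_right G g).symm
    (BraidedCategory.braiding_naturality_left f B).symm

lemma hasLiftingProperty_pushoutProduct_comm {F G A B P Q : SPre C} {f : F ⟶ G} {g : A ⟶ B}
    {p : P ⟶ Q} (h : HasLiftingProperty (pushoutProduct f g) p) :
    HasLiftingProperty (pushoutProduct g f) p :=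
  HasLiftingProperty.of_arrow_iso_left (pushoutProductSymmetry f g) p

/-! ### The Yoneda lemma -/

/-- Maps from the tensor of a representable with `K` to `F` correspond to maps from `K` to a value
of `F`. -/
def representableTensorHomEquiv (X : C) (K : SSet.{u}) (F : SPre C) :
    ((discrete C).obj (yoneda.obj X) ⊗ (constant C).obj K ⟶ F) ≃ (K ⟶ F.obj (op X)) where
  toFun f :=
    { app n := ↾fun k => (f.app (op X)).app n (𝟙 X, k)
      naturality n m φ := ConcreteCategory.hom_ext _ _ fun k => by
        have h := (f.app (op X)).naturality φ
        exact congr($h (𝟙 X, k)) }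
  invFun f :=
    { app Y :=
        { app n := ↾fun z => (F.map (show Y.unop ⟶ X from z.1).op).app n (f.app n z.2)
          naturality n m φ := ConcreteCategory.hom_ext _ _ fun z => by
            have h := (f ≫ F.map (show Y.unop ⟶ X from z.1).op).naturality φ
            exact congr($h z.2) }
      naturality Y Z v := by
        ext n z
        exact congr(($(F.map_comp (show Y.unop ⟶ X from z.1).op v)).app n (f.app n z.2)) }
  left_inv f := by
    ext Y n z
    obtain ⟨z, k⟩ := z
    refine (congr((($(f.naturality (show Y.unop ⟶ X from z).op)).app n) (𝟙 X, k))).symm.trans ?_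
    exact congr_arg (fun z => (f.app Y).app n (z, k)) (Category.comp_id (show Y.unop ⟶ X from z))
  right_inv f := by
    ext n k
    exact congr(($(F.map_id (op X))).app n (f.app n k))

/-- Evaluation at `X` is right adjoint to the tensor with `X`. -/
def representableTensorAdjunction (X : C) :
    constant C ⋙ tensorLeft ((discrete C).obj (yoneda.obj X)) ⊣ (evaluation _ _).obj (op X) :=
  Adjunction.mkOfHomEquiv
    { homEquiv := representableTensorHomEquiv X
      homEquiv_naturality_left_symm _ _ := rfl
      homEquiv_naturality_right _ _ := rfl }

/-- The empty union is the empty presheaf, so the pushout product is `X ⊗ K ⟶ X ⊗ L`, and tensoring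
with `X` is left adjoint to evaluation at `X`. -/
lemma hasLiftingProperty_unionProduct_empty_iff {X : C} {U : Fin 0 → C} (i : ∀ a, U a ⟶ X)
    {K L : SSet.{u}} (g : K ⟶ L) [Mono g] {P Q : SPre C} (p : P ⟶ Q) :
    HasLiftingProperty (unionProduct i g) p ↔ HasLiftingProperty g (p.app (op X)) := by
  have hg := injective_constant (C := C) g
  have hm : Injective ((discrete C).obj (yoneda.obj X) ◁ (constant C).map g) :=
    fun Y n z z' h => Prod.ext congr(($h).1) (hg Y n congr(($h).2))
  have hr (Y n z) : z ∈ range ((discrete C).obj (yoneda.obj X) ◁ (constant C).map g) Y n ↔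
      z ∈ range (unionProduct i g) Y n := by
    obtain ⟨z, l⟩ := z
    refine Iff.trans ?_ (mem_range_unionProduct i g _ _).symm
    constructor
    · rintro ⟨⟨z', k⟩, h⟩
      exact .inr ⟨k, congr(($h).2)⟩
    · rintro (⟨a, _⟩ | ⟨k, h⟩)
      · exact a.elim0
      · exact ⟨(z, k), Prod.ext rfl h⟩
  have hu := injective_unionProduct i g
  refine Iff.trans ⟨fun h => ?_, fun h => ?_⟩
    ((representableTensorAdjunction X).hasLiftingProperty_iff g p)
  · exact hu.hasLiftingProperty_of_range hm (Iso.refl _) (fun X n b => (hr X n b).symm) p h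
  · exact hm.hasLiftingProperty_of_range hu (Iso.refl _) hr p h

/-! ### Objectwise properties of flasque fibrations -/

lemma mono_of_J {K L : SSet.{u}} {g : K ⟶ L} (hg : J g) : Mono g := by
  exact mono_of_anodyne (anodyneExtensions_eq_llp_rlp ▸ MorphismProperty.le_llp_rlp _ _ hg)

lemma hasLiftingProperty_unionProduct_of_J {P Q : SPre C} {p : P ⟶ Q} (hp : flasqueFibrations C p)
    {X : C} {n : ℕ} {U : Fin n → C} (i : ∀ a, U a ⟶ X) (hi : ∀ a, Mono (i a)) {K L : SSet.{u}}
    (g : K ⟶ L) (hg : J g) : HasLiftingProperty (unionProduct i g) p :=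
  hp _ (.mk i hi g hg)

/-- By adjunction, lifting for all horns says that a map of mapping spaces is a Kan fibration, which
then lifts against every anodyne extension. -/
lemma hasLiftingProperty_unionProduct_of_anodyne {P Q : SPre C} {p : P ⟶ Q}
    (hp : flasqueFibrations C p) {X : C} {n : ℕ} {U : Fin n → C} (i : ∀ a, U a ⟶ X)
    (hi : ∀ a, Mono (i a)) {K L : SSet.{u}} (g : K ⟶ L) (hg : anodyneExtensions g) :
    HasLiftingProperty (unionProduct i g) p := by
  rw [hasLiftingProperty_pushoutProduct_constant_iff]
  have : Fibration (mapPullback (unionInclusion i) p) := by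
    rw [fibration_iff]
    intro _ _ g hg
    rw [← hasLiftingProperty_pushoutProduct_constant_iff]
    exact hasLiftingProperty_unionProduct_of_J hp i hi g hg
  exact hasLiftingProperty_of_anodyne hg _

lemma fibration_app {P Q : SPre C} {p : P ⟶ Q} (hp : flasqueFibrations C p) (X : C) :
    kanFibrations (p.app (op X)) := by
  intro _ _ g hg
  have := mono_of_J hg
  exact (hasLiftingProperty_unionProduct_empty_iff (U := Fin.elim0) (fun a => a.elim0) g p).1
    (hasLiftingProperty_unionProduct_of_J hp _ (fun a => a.elim0) g hg)

lemma trivFib_app {P Q : SPre C} {p : P ⟶ Q} (hp : (flasqueFibrations C ⊓ objectwiseWeq) p)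
    (X : C) : TrivFib (p.app (op X)) :=
  (trivFib_iff _).2 ⟨fibration_app hp.1 X, hp.2 X⟩

end

section

variable {C : Type u} [SmallCategory C]

/-! ### Generating cofibrations -/

variable (C) in
/-- Generating flasque cofibrations: the generating acyclic cofibrations together with the tensors
of representables with monomorphisms of simplicial sets. -/
inductive generatingCofibrations : MorphismProperty (SPre C) where
  | mk {X : C} {n : ℕ} {U : Fin n → C} {K L : SSet.{u}} (i : ∀ a, U a ⟶ X)
      (hi : ∀ a, Mono (i a)) (g : K ⟶ L) (hg : Mono g) (h : J g ∨ n = 0) :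
      generatingCofibrations (unionProduct i g)

lemma generatingAcyclicCofibrations_le :
    generatingAcyclicCofibrations C ≤ generatingCofibrations C := by
  rintro _ _ _ ⟨i, hi, g, hg⟩
  exact .mk i hi g (mono_of_J hg) (.inl hg)

/-- The generators with empty union test whether each `p(X)` is a trivial fibration, that is, a Kan
fibration and a weak equivalence by `trivFib_iff`. -/
lemma rlp_generatingCofibrations :
    (generatingCofibrations C).rlp = flasqueFibrations C ⊓ objectwiseWeq := by
  ext P Q p
  constructor
  · intro hp
    refine ⟨fun _ _ j hj => hp j (generatingAcyclicCofibrations_le _ hj), fun X => ?_⟩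
    refine ((trivFib_iff _).1 fun _ _ g hg => ?_).2
    have : Mono g := hg
    exact (hasLiftingProperty_unionProduct_empty_iff (U := Fin.elim0) (fun a => a.elim0) g p).1
      (hp _ (.mk _ (fun a => a.elim0) g this (.inr rfl)))
  · rintro hp _ _ _ ⟨i, hi, g, hg, hg' | rfl⟩
    · exact hasLiftingProperty_unionProduct_of_J hp.1 i hi g hg'
    · exact (hasLiftingProperty_unionProduct_empty_iff i g p).2 (trivFib_app hp _ g hg)

lemma flasqueCofibrations_eq :
    flasqueCofibrations C = (generatingCofibrations C).rlp.llp := by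
  rw [rlp_generatingCofibrations]
  rfl

lemma llp_flasqueFibrations_le : (flasqueFibrations C).llp ≤ flasqueCofibrations C :=
  fun _ _ _ hi _ _ p hp => hi p hp.1

/-- If pushout products of maps in `S` and `T` lift against maps in `R`, then this also holds for
maps in the saturations of `S` and `T`. -/
lemma hasLiftingProperty_pushoutProduct_of_saturation {S T R : MorphismProperty (SPre C)}
    (H : ∀ {F G A B P Q : SPre C} {j : F ⟶ G} {k : A ⟶ B} {p : P ⟶ Q}, S j → T k → R p →
      HasLiftingProperty (pushoutProduct j k) p) {F G A B P Q : SPre C} {f : F ⟶ G} {g : A ⟶ B}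
    {p : P ⟶ Q} (hf : S.rlp.llp f) (hg : T.rlp.llp g) (hp : R p) :
    HasLiftingProperty (pushoutProduct f g) p := by
  have h {M N : SPre C} (k : M ⟶ N) (hk : T k) : HasLiftingProperty (pushoutProduct f k) p := by
    refine hasLiftingProperty_pushoutProduct_comm ?_
    rw [hasLiftingProperty_pushoutProduct_iff]
    refine hf _ fun _ _ j hj => ?_
    rw [← hasLiftingProperty_pushoutProduct_iff]
    exact hasLiftingProperty_pushoutProduct_comm (H hj hk hp)
  rw [hasLiftingProperty_pushoutProduct_iff]
  refine hg _ fun _ _ k hk => ?_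
  rw [← hasLiftingProperty_pushoutProduct_iff]
  exact h k hk

variable [HasFiniteProducts C]

/-- If one factor comes from a horn, `g □ h` is anodyne and being a flasque fibration suffices.
Otherwise both unions are empty, so is the combined one, and objectwise triviality applies. -/
lemma hasLiftingProperty_generatingCofibrations {F G A B P Q : SPre C} {j : F ⟶ G} {k : A ⟶ B}
    {p : P ⟶ Q} (hj : generatingCofibrations C j) (hk : generatingCofibrations C k)
    (hp : (flasqueFibrations C ⊓ objectwiseWeq) p) :
    HasLiftingProperty (pushoutProduct j k) p := by
  obtain @⟨X, n, U, K, L, i, hi, g, hg, hg'⟩ := hj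
  obtain @⟨Y, m, V, M, N, j, hj, h, hh, hh'⟩ := hk
  refine hasLiftingProperty_pushoutProduct_unionProduct i j hi hj g h p fun W k hk => ?_
  obtain hg' | rfl := hg'
  · exact hasLiftingProperty_unionProduct_of_anodyne hp.1 _ hk _
      (anodyneExtensions_pushoutObjObjι' _ (MorphismProperty.le_llp_rlp _ _ hg'))
  obtain hh' | rfl := hh'
  · exact hasLiftingProperty_unionProduct_of_anodyne hp.1 _ hk _
      (anodyneExtensions_pushoutObjObjι _ (MorphismProperty.le_llp_rlp _ _ hh'))
  have := mono_pushoutObjObj_ι (Functor.PushoutObjObj.ofHasPushout (curriedTensor SSet.{u}) g h)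
  exact (hasLiftingProperty_unionProduct_empty_iff (U := W) k _ p).2 (trivFib_app hp _ _ this)

lemma hasLiftingProperty_generatingAcyclicCofibrations {F G A B P Q : SPre C} {j : F ⟶ G}
    {k : A ⟶ B} {p : P ⟶ Q} (hj : generatingAcyclicCofibrations C j)
    (hk : generatingCofibrations C k) (hp : flasqueFibrations C p) :
    HasLiftingProperty (pushoutProduct j k) p := by
  obtain @⟨X, n, U, K, L, i, hi, g, hg⟩ := hj
  obtain @⟨Y, m, V, M, N, j, hj, h, hh, hh'⟩ := hk
  have := mono_of_J hg
  refine hasLiftingProperty_pushoutProduct_unionProduct i j hi hj g h p fun W k hk => ?_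
  exact hasLiftingProperty_unionProduct_of_anodyne hp _ hk _
    (anodyneExtensions_pushoutObjObjι' _ (MorphismProperty.le_llp_rlp _ _ hg))

/-! ### Pushout products of flasque cofibrations -/

lemma flasqueCofibrations_pushoutProduct {F G A B : SPre C} {f : F ⟶ G} {g : A ⟶ B}
    (hf : flasqueCofibrations C f) (hg : flasqueCofibrations C g) :
    flasqueCofibrations C (pushoutProduct f g) := by
  rw [flasqueCofibrations_eq] at hf hg
  exact fun _ _ p hp => hasLiftingProperty_pushoutProduct_of_saturation
    hasLiftingProperty_generatingCofibrations hf hg hp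

lemma llp_flasqueFibrations_pushoutProduct {F G A B : SPre C} {f : F ⟶ G} {g : A ⟶ B}
    (hf : (flasqueFibrations C).llp f) (hg : flasqueCofibrations C g) :
    (flasqueFibrations C).llp (pushoutProduct f g) := by
  rw [flasqueCofibrations_eq] at hg
  exact fun _ _ p hp => hasLiftingProperty_pushoutProduct_of_saturation
    hasLiftingProperty_generatingAcyclicCofibrations hf hg hp

lemma llp_flasqueFibrations_pushoutProduct' {F G A B : SPre C} {f : F ⟶ G} {g : A ⟶ B}
    (hf : flasqueCofibrations C f) (hg : (flasqueFibrations C).llp g) :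
    (flasqueFibrations C).llp (pushoutProduct f g) :=
  fun _ _ p hp => hasLiftingProperty_pushoutProduct_comm
    (llp_flasqueFibrations_pushoutProduct hg hf p hp)

end

section

variable {C : Type u} [SmallCategory C]

/-! ### Flasque acyclic cofibrations -/

lemma anodyneExtensions_pushoutProduct_constant_app {F G : SPre C} {f : F ⟶ G} (hf : Injective f)
    {K L : SSet.{u}} {g : K ⟶ L} (hg : anodyneExtensions g) (Y : Cᵒᵖ) :
    anodyneExtensions ((pushoutProduct f ((constant C).map g)).app Y) := by
  have : Mono (f.app Y) := mono_of_injective _ (hf Y)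
  have := mono_of_anodyne hg
  let sq : (curriedTensor SSet.{u}).PushoutObjObj (f.app Y) g :=
    { pt := (pushout (f ▷ (constant C).obj K) (F ◁ (constant C).map g)).obj Y
      inl := (pushout.inl (f ▷ (constant C).obj K) (F ◁ (constant C).map g)).app Y
      inr := (pushout.inr (f ▷ (constant C).obj K) (F ◁ (constant C).map g)).app Y
      isPushout := (IsPushout.of_hasPushout (f ▷ (constant C).obj K)
        (F ◁ (constant C).map g)).map ((evaluation _ _).obj Y)
      ι := (pushoutProduct f ((constant C).map g)).app Y
      inl_ι := congr(($(pushout.inl_desc (G ◁ (constant C).map g) (f ▷ (constant C).obj L)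
        (whisker_exchange f ((constant C).map g)).symm)).app Y)
      inr_ι := congr(($(pushout.inr_desc (G ◁ (constant C).map g) (f ▷ (constant C).obj L)
        (whisker_exchange f ((constant C).map g)).symm)).app Y) }
  exact anodyneExtensions_pushoutObjObjι sq hg

lemma anodyneExtensions_app_of_generating {F G : SPre C} {j : F ⟶ G}
    (hj : generatingAcyclicCofibrations C j) (Z : Cᵒᵖ) : anodyneExtensions (j.app Z) := by
  obtain ⟨i, _, g, hg⟩ := hj
  exact anodyneExtensions_pushoutProduct_constant_app (injective_unionInclusion i)
    (MorphismProperty.le_llp_rlp _ _ hg) Z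

/-- Right Kan extensions of Kan fibrations along objects are flasque fibrations. -/
lemma flasqueFibrations_evaluationRightAdjoint_map (Y : Cᵒᵖ) {E B : SSet.{u}} (q : E ⟶ B)
    [Fibration q] : flasqueFibrations C ((evaluationRightAdjoint SSet.{u} Y).map q) := by
  intro F G j hj
  refine ((evaluationAdjunctionLeft SSet.{u} Y).hasLiftingProperty_iff j q).1 ?_
  exact hasLiftingProperty_of_anodyne (anodyneExtensions_app_of_generating hj Y) q

/-- Evaluation at `Y` has a right adjoint carrying Kan fibrations to flasque fibrations; lifting
transposes. -/
lemma anodyneExtensions_app {A B : SPre C} {i : A ⟶ B} (hi : (flasqueFibrations C).llp i)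
    (Y : Cᵒᵖ) : anodyneExtensions (i.app Y) := by
  intro E B q hq
  have : Fibration q := ⟨hq⟩
  exact ((evaluationAdjunctionLeft SSet.{u} Y).hasLiftingProperty_iff i q).2
    (hi _ (flasqueFibrations_evaluationRightAdjoint_map Y q))

/-- The flasque acyclic cofibrations are the maps with the left lifting property with respect to
flasque fibrations. -/
lemma llp_flasqueFibrations_iff {A B : SPre C} (i : A ⟶ B) :
    (flasqueFibrations C).llp i ↔ flasqueCofibrations C i ∧ objectwiseWeq i := by
  constructor
  · exact fun hi => ⟨llp_flasqueFibrations_le _ hi,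
      fun X => anodyneExtensions.weakEquivalences (anodyneExtensions_app hi (op X))⟩
  · rintro ⟨hi, hi'⟩
    -- Retract argument: `p` is an objectwise weak equivalence by two-out-of-three, so `i` lifts
    -- against it and is a retract of `j`.
    obtain ⟨H, j, p, hj, hp, rfl⟩ := exists_factorization_flasqueFibrations i
    have hp' : objectwiseWeq p := fun X => weakEquivalences_of_precomp
      (anodyneExtensions.weakEquivalences (anodyneExtensions_app hj (op X))) (hi' X)
    have := hi p ⟨hp, hp'⟩
    exact MorphismProperty.of_retract (RetractArrow.ofLeftLiftingProperty rfl) hj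

/-! ### Constant simplicial presheaves -/

variable [HasFiniteProducts C]

/-- The tensor with the terminal object. -/
def terminalTensorIso (K : SSet.{u}) :
    (discrete C).obj (yoneda.obj (⊤_ C)) ⊗ (constant C).obj K ≅ (constant C).obj K where
  hom := snd _ _
  inv := lift
    { app _ := { app _ := ↾fun _ => terminal.from _ }
      naturality Y Z f := by
        ext n z
        exact Subsingleton.elim (α := Z.unop ⟶ ⊤_ C) _ _ } (𝟙 _)
  hom_inv_id := by
    apply CartesianMonoidalCategory.hom_ext
    · ext Y n z
      exact Subsingleton.elim (α := Y.unop ⟶ ⊤_ C) _ _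
    · rfl
  inv_hom_id := lift_snd _ _

/-- The constant presheaf on `K` is the tensor of the terminal representable with `K`, so lifting is
tested at `⊤_ C`. -/
lemma hasLiftingProperty_constant_map {K L : SSet.{u}} (g : K ⟶ L) [Mono g] {P Q : SPre C}
    (p : P ⟶ Q) (h : HasLiftingProperty g (p.app (op (⊤_ C)))) :
    HasLiftingProperty ((constant C).map g) p := by
  refine (injective_unionProduct (X := ⊤_ C) (U := Fin.elim0) (fun a => a.elim0)
    g).hasLiftingProperty_of_range (injective_constant g) (terminalTensorIso L) ?_ p
      ((hasLiftingProperty_unionProduct_empty_iff _ g p).2 h)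
  rintro Y n ⟨z, l⟩
  refine (mem_range_unionProduct _ g _ _).trans (or_iff_right ?_)
  rintro ⟨a, _⟩
  exact a.elim0

lemma flasqueCofibrations_constant_map {K L : SSet.{u}} (g : K ⟶ L) [hg : Mono g] :
    flasqueCofibrations C ((constant C).map g) :=
  fun _ _ p hp => hasLiftingProperty_constant_map g p (trivFib_app hp _ _ hg)

lemma llp_flasqueFibrations_constant_map {K L : SSet.{u}} (g : K ⟶ L) (hg : J g) :
    (flasqueFibrations C).llp ((constant C).map g) := fun _ _ p hp =>
  have := mono_of_J hg
  hasLiftingProperty_constant_map g p (fibration_app hp _ g hg)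

/-! ### Function objects and mapping spaces -/

lemma flasqueFibrations_homPullback {A B F G : SPre C} {i : A ⟶ B} {f : F ⟶ G}
    (hi : flasqueCofibrations C i) (hf : flasqueFibrations C f) :
    flasqueFibrations C (homPullback i f) := fun _ _ j hj =>
  (hasLiftingProperty_pushoutProduct_iff i j f).1
    (llp_flasqueFibrations_pushoutProduct' hi (MorphismProperty.le_llp_rlp _ _ hj) f hf)

lemma objectwiseWeq_homPullback {A B F G : SPre C} {i : A ⟶ B} {f : F ⟶ G}
    (hi : flasqueCofibrations C i) (hf : flasqueFibrations C f)
    (h : objectwiseWeq i ∨ objectwiseWeq f) : objectwiseWeq (homPullback i f) := by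
  suffices (flasqueFibrations C ⊓ objectwiseWeq) (homPullback i f) from this.2
  rw [← rlp_generatingCofibrations]
  intro _ _ j hj
  replace hj : flasqueCofibrations C j := by
    rw [flasqueCofibrations_eq]
    exact MorphismProperty.le_llp_rlp _ _ hj
  rw [← hasLiftingProperty_pushoutProduct_iff]
  obtain h | h := h
  · exact llp_flasqueFibrations_pushoutProduct ((llp_flasqueFibrations_iff i).2 ⟨hi, h⟩) hj f hf
  · exact flasqueCofibrations_pushoutProduct hi hj f ⟨hf, h⟩

lemma kanFibrations_mapPullback {A B F G : SPre C} {i : A ⟶ B} {f : F ⟶ G}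
    (hi : flasqueCofibrations C i) (hf : flasqueFibrations C f) :
    kanFibrations (mapPullback i f) := fun _ _ g hg =>
  (hasLiftingProperty_pushoutProduct_constant_iff i g f).1
    (llp_flasqueFibrations_pushoutProduct' hi (llp_flasqueFibrations_constant_map g hg) f hf)

lemma weakEquivalences_mapPullback {A B F G : SPre C} {i : A ⟶ B} {f : F ⟶ G}
    (hi : flasqueCofibrations C i) (hf : flasqueFibrations C f)
    (h : objectwiseWeq i ∨ objectwiseWeq f) : weakEquivalences (mapPullback i f) := by
  refine ((trivFib_iff _).1 fun _ _ g (hg : Mono g) => ?_).2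
  have hg := flasqueCofibrations_constant_map (C := C) g
  rw [← hasLiftingProperty_pushoutProduct_constant_iff]
  obtain h | h := h
  · exact llp_flasqueFibrations_pushoutProduct ((llp_flasqueFibrations_iff i).2 ⟨hi, h⟩) hg f hf
  · exact flasqueCofibrations_pushoutProduct hi hg f ⟨hf, h⟩

lemma objectwiseWeq_pushoutProduct {F G A B : SPre C} {f : F ⟶ G} {g : A ⟶ B}
    (hf : flasqueCofibrations C f) (hg : flasqueCofibrations C g)
    (h : objectwiseWeq f ∨ objectwiseWeq g) : objectwiseWeq (pushoutProduct f g) := by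
  obtain h | h := h
  · exact ((llp_flasqueFibrations_iff _).1 (llp_flasqueFibrations_pushoutProduct
      ((llp_flasqueFibrations_iff f).2 ⟨hf, h⟩) hg)).2
  · exact ((llp_flasqueFibrations_iff _).1 (llp_flasqueFibrations_pushoutProduct'
      hf ((llp_flasqueFibrations_iff g).2 ⟨hg, h⟩))).2

end

end Flasque

end

theorem proposition3p11 (C : Type u) [SmallCategory C] [HasFiniteProducts C] :
    (∀ {F G A B : Flasque.SPre C} (f : F ⟶ G) (g : A ⟶ B),
      Flasque.flasqueCofibrations C f → Flasque.flasqueCofibrations C g →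
        Flasque.flasqueCofibrations C (Flasque.pushoutProduct f g) ∧
        (Flasque.objectwiseWeq f ∨ Flasque.objectwiseWeq g →
          Flasque.objectwiseWeq (Flasque.pushoutProduct f g))) ∧
    (∀ {A B F G : Flasque.SPre C} (i : A ⟶ B) (f : F ⟶ G),
      Flasque.flasqueCofibrations C i → Flasque.flasqueFibrations C f →
        Flasque.flasqueFibrations C (Flasque.homPullback i f) ∧
        (Flasque.objectwiseWeq i ∨ Flasque.objectwiseWeq f →
          Flasque.objectwiseWeq (Flasque.homPullback i f))) ∧
    (∀ {A B F G : Flasque.SPre C} (i : A ⟶ B) (f : F ⟶ G),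
      Flasque.flasqueCofibrations C i → Flasque.flasqueFibrations C f →
        Flasque.kanFibrations (Flasque.mapPullback i f) ∧
        (Flasque.objectwiseWeq i ∨ Flasque.objectwiseWeq f →
          Flasque.weakEquivalences (Flasque.mapPullback i f))) := by
  exact ⟨fun f g hf hg => ⟨Flasque.flasqueCofibrations_pushoutProduct hf hg,
      Flasque.objectwiseWeq_pushoutProduct hf hg⟩,
    fun i f hi hf => ⟨Flasque.flasqueFibrations_homPullback hi hf,
      Flasque.objectwiseWeq_homPullback hi hf⟩,
    fun i f hi hf => ⟨Flasque.kanFibrations_mapPullback hi hf,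
      Flasque.weakEquivalences_mapPullback hi hf⟩⟩
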